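/- **Setting.** Let the variables $x_1,\dots,x_n$ be partitioned into pairwise disjoint (possibly empty) sets $\mathcal X_{j_1,\dots,j_m}$, indexed by the tuples $(j_1,\dots,j_m)$ with $0\le m\le M$ and $1\le j_k\le J_k$, and ordered by resolution: if $i>j$, $x_i\in\mathcal X_{i_1,\dots,i_m}$ and $x_j\in\mathcal X_{j_1,\dots,j_l}$, then $m\ge l$. Let $\mathcal A_{j_1,\dots,j_m}=\bigcup_{k<m}\mathcal X_{j_1,\dots,j_k}$ be the set of ancestors of $\mathcal X_{j_1,\dots,j_m}$, and for $x_i\in\mathcal X_{j_1,\dots,j_m}$ let $\mathcal C_i=\mathcal A_{j_1,\dots,j_m}\cup\{x_k\in\mathcal X_{j_1,\dots,j_m}:k<i\}$. Let $p$ be the density of $\mathcal N_n(\boldsymbol\mu,\boldsymbol\Sigma)$ with $\boldsymbol\Sigma$ positive definite. The hierarchical Vecchia (HV) approximation of $p$ is $$\hat p(\mathbf x)=\prod_{m=0}^M\prod_{j_1,\dots,j_m}p(\mathcal X_{j_1,\dots,j_m}\mid\mathcal A_{j_1,\dots,j_m}).$$ For a positive definite matrix $\mathbf A$, let $\mathrm{chol}(\mathbf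 A)$ be its lower triangular Cholesky factor with positive diagonal, and $\mathrm{rchol}(\mathbf A)=\mathbf P\,\mathrm{chol}(\mathbf P\mathbf A\mathbf P)\,\mathbf P$, where $\mathbf P$ is the permutation matrix that reverses the order of the indices. **Proposition.** Let $\mathbf x$ have the density $\hat p$, with covariance matrix $\hat{\boldsymbol\Sigma}$. Let $\mathcal I\subset\{1,\dots,n\}$, let $\tau_i>0$ for $i\in\mathcal I$, and suppose that, given $\mathbf x$, the data $y_i\sim\mathcal N(x_i,\tau_i^2)$, $i\in\mathcal I$, are independent. Let $\widetilde{\boldsymbol\Sigma}=\mathrm{var}(\mathbf x\mid\mathbf y)$ be the posterior covariance matrix, and put $$\mathbf U=\mathrm{rchol}(\hat{\boldsymbol\Sigma}^{-1}),\quad \widetilde{\mathbf U}=\mathrm{rchol}(\widetilde{\boldsymbol\Sigma}^{-1}),\quad \mathbf L=\mathrm{chol}(\hat{\boldsymbol\Sigma}),\quad \widetilde{\mathbf L}=\mathrm{chol}(\widetilde{\boldsymbol\Sigma}).$$ Then, for every data vector $\mathbf y$, these matrices are well defined (the prior and the posterior are probability distributions with finite second moments and positive definite covariance matrices), and: 1.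 $\widetilde{\mathbf U}$ has the same sparsity pattern as $\mathbf U$, namely the positions $(j,i)$ with $j=i$ or $x_j\in\mathcal C_i$; 2. $\widetilde{\mathbf L}$ has the same sparsity pattern as $\mathbf L$, namely the positions $(i,j)$ with $j=i$ or $x_j\in\mathcal C_i$ (so there is no fill-in). Here the sparsity pattern is the structural one determined by the hierarchy, in the following sense. For every positive definite $\boldsymbol\Sigma$, all entries of the four matrices outside the stated positions are zero. For fixed hierarchy, $\boldsymbol\mu$, $\mathcal I$ and $(\tau_i)$, and for all $\boldsymbol\Sigma$ in an open dense subset of the positive definite matrices, the sets of positions of the nonzero entries of $\widetilde{\mathbf U}$ and $\mathbf U$ coincide and are exactly those stated in 1, and the sets of positions of the nonzero entries of $\widetilde{\mathbf L}$ and $\mathbf L$ coincide and are exactly those stated in 2, for every $\mathbf y$. -/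

import Mathlib

open MeasureTheory ProbabilityTheory

namespace HV

noncomputable section

/-- A hierarchical partition of the variables `x_0, …, x_{n-1}` with resolutions `0, …, M`.
A node is a tuple `(j_1, …, j_m)` with `m ≤ M` and `j_k` one of `J_k` values (the field `J` is
indexed from zero, `J k` is `J_{k+1}`); the set `X_{j_1,…,j_m}` consists of the variables assigned to that node by `node`.
(A family of pairwise disjoint, possibly empty sets which cover all variables is the same
thing as such an assignment.) The variables are ordered by resolution. -/
structure Hierarchy (n : ℕ) where
  M : ℕ
  J : ℕ → ℕ
  node : Fin n → (Σ m : Fin (M + 1), ((k : Fin (m : ℕ)) → Fin (J k)))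
  ordered : ∀ i j : Fin n, j < i → (node j).1 ≤ (node i).1

namespace Hierarchy

variable {n : ℕ} (H : Hierarchy n)

/-- The nodes of the hierarchy: tuples `(j_1, …, j_m)`, `0 ≤ m ≤ M`. -/
abbrev Node : Type := Σ m : Fin (H.M + 1), ((k : Fin (m : ℕ)) → Fin (H.J k))

/-- `a` is a proper initial segment of `b`. -/
def IsAncestor (a b : H.Node) : Prop :=
  ∃ h : (a.1 : ℕ) < b.1, ∀ k : Fin (a.1 : ℕ), b.2 ⟨k, k.2.trans h⟩ = a.2 k

open Classical in
/-- The (indices of the) variables in the set `X_a` of the node `a`. -/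
def members (a : H.Node) : Finset (Fin n) := {i | H.node i = a}

open Classical in
/-- The (indices of the) variables in the ancestor set `A_a`: the union of the sets `X_b`
over all proper initial segments `b` of `a`. -/
def ancestors (a : H.Node) : Finset (Fin n) := {i | H.IsAncestor (H.node i) a}

open Classical in
/-- The conditioning set `C_i` of a single variable `x_i`: the ancestor set of its node,
together with the previous variables in the same node. -/
def condSet (i : Fin n) : Finset (Fin n) :=
  H.ancestors (H.node i) ∪ {k ∈ H.members (H.node i) | k < i}

/-- The lower triangular pattern: positions `(i, j)` such that `j = i` or `x_j ∈ C_i`. -/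
def lowerPattern : Set (Fin n × Fin n) := {p | p.2 = p.1 ∨ p.2 ∈ H.condSet p.1}

/-- The transposed, upper triangular pattern: positions `(j, i)` with `j = i` or `x_j ∈ C_i`. -/
def upperPattern : Set (Fin n × Fin n) := {p | p.1 = p.2 ∨ p.1 ∈ H.condSet p.2}

end Hierarchy

/-- The density of the normal distribution with mean `m` and positive definite covariance
matrix `S` with respect to Lebesgue measure (it is `1` on the one-point space `ℝ^∅`). -/
def gaussianDensity {ι : Type*} [Fintype ι] [DecidableEq ι] (m : ι → ℝ) (S : Matrix ι ι ℝ)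
    (x : ι → ℝ) : ℝ :=
  (Real.sqrt ((2 * Real.pi) ^ Fintype.card ι * S.det))⁻¹ *
    Real.exp (-(1 / 2) * ((x - m) ⬝ᵥ (S⁻¹.mulVec (x - m))))

variable {n : ℕ}

/-- The joint density `p(x_s)` of the variables `x_i`, `i ∈ s`, of a Gaussian vector with mean
`μ` and covariance matrix `S`, that is, of `N(μ_s, S_{s,s})`, at the coordinates of `x`. -/
def subDensity (μ : Fin n → ℝ) (S : Matrix (Fin n) (Fin n) ℝ) (s : Finset (Fin n))
    (x : Fin n → ℝ) : ℝ :=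
  gaussianDensity (fun i : s => μ i)
    (S.submatrix (fun i : s => (i : Fin n)) (fun i : s => (i : Fin n))) (fun i : s => x i)

/-- The conditional density `p(x_s | x_t) = p(x_{s ∪ t}) / p(x_t)`. -/
def condDensity (μ : Fin n → ℝ) (S : Matrix (Fin n) (Fin n) ℝ) (s t : Finset (Fin n))
    (x : Fin n → ℝ) : ℝ :=
  subDensity μ S (s ∪ t) x / subDensity μ S t x

/-- The density of the hierarchical Vecchia approximation of `N(μ, S)`: the product of
`p(X_a | A_a)` over all nodes `a`. -/
def hvDensity (H : Hierarchy n) (μ : Fin n → ℝ) (S : Matrix (Fin n) (Fin n) ℝ)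
    (x : Fin n → ℝ) : ℝ :=
  ∏ a : H.Node, condDensity μ S (H.members a) (H.ancestors a) x

/-- The hierarchical Vecchia approximation of `N(μ, S)` as a measure: the prior of `x`. -/
def hvPrior (H : Hierarchy n) (μ : Fin n → ℝ) (S : Matrix (Fin n) (Fin n) ℝ) :
    Measure (Fin n → ℝ) :=
  volume.withDensity fun x => ENNReal.ofReal (hvDensity H μ S x)

/-- The density `p(y | x)` of the data: the `y_i`, `i ∈ I`, are independent given `x`, with
`y_i | x ∼ N(x_i, τ_i ^ 2)`. -/
def likelihood (I : Finset (Fin n)) (τ : I → ℝ) (y : I → ℝ) (x : Fin n → ℝ) : ℝ :=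
  ∏ i : I, gaussianPDFReal (x i) (τ i ^ 2).toNNReal (y i)

/-- The conditional density of `x` given `y` by Bayes' formula, for the prior `hvPrior H μ S`. -/
def posteriorDensity (H : Hierarchy n) (μ : Fin n → ℝ) (S : Matrix (Fin n) (Fin n) ℝ)
    (I : Finset (Fin n)) (τ : I → ℝ) (y : I → ℝ) (x : Fin n → ℝ) : ℝ :=
  hvDensity H μ S x * likelihood I τ y x / ∫ z, hvDensity H μ S z * likelihood I τ y z

/-- The posterior distribution of `x` given the data `y`. -/
def hvPosterior (H : Hierarchy n) (μ : Fin n → ℝ) (S : Matrix (Fin n) (Fin n) ℝ)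
    (I : Finset (Fin n)) (τ : I → ℝ) (y : I → ℝ) : Measure (Fin n → ℝ) :=
  volume.withDensity fun x => ENNReal.ofReal (posteriorDensity H μ S I τ y x)

/-- The covariance matrix of a distribution on `ℝ^n`. -/
def covMatrix (P : Measure (Fin n → ℝ)) : Matrix (Fin n) (Fin n) ℝ :=
  Matrix.of fun i j => covariance (fun x : Fin n → ℝ => x i) (fun x => x j) P

/-- `L` is a Cholesky factor of `A`: lower triangular with positive diagonal and `L Lᵀ = A`. -/
def IsChol (A L : Matrix (Fin n) (Fin n) ℝ) : Prop :=
  (∀ i j, i < j → L i j = 0) ∧ (∀ i, 0 < L i i) ∧ L * L.transpose = A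

open Classical in
/-- The Cholesky factor of `A` (it exists, and is unique, if `A` is positive definite). -/
def chol (A : Matrix (Fin n) (Fin n) ℝ) : Matrix (Fin n) (Fin n) ℝ :=
  if h : ∃ L, IsChol A L then h.choose else 0

/-- `P A P` for the permutation matrix `P` which reverses the order of the indices. -/
def reverse (A : Matrix (Fin n) (Fin n) ℝ) : Matrix (Fin n) (Fin n) ℝ :=
  A.submatrix Fin.rev Fin.rev

/-- The Cholesky factor under reverse ordering, `P chol(P A P) P`. -/
def rchol (A : Matrix (Fin n) (Fin n) ℝ) : Matrix (Fin n) (Fin n) ℝ :=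
  reverse (chol (reverse A))

/-- The distribution `P` is a probability measure with finite second moments, and its covariance
matrix is positive definite. Moreover, `chol` is a genuine Cholesky factor of the covariance matrix
and of the precision matrix in reverse order. So all objects in the result exist. -/
def WellDefined (P : Measure (Fin n → ℝ)) : Prop :=
  IsProbabilityMeasure P ∧ (∀ i, MemLp (fun x : Fin n → ℝ => x i) 2 P) ∧
    (covMatrix P).PosDef ∧ IsChol (covMatrix P) (chol (covMatrix P)) ∧
    IsChol (reverse (covMatrix P)⁻¹) (chol (reverse (covMatrix P)⁻¹))

/-- The positions of the nonzero entries of a matrix. -/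
def nonzeros (A : Matrix (Fin n) (Fin n) ℝ) : Set (Fin n × Fin n) := {p | A p.1 p.2 ≠ 0}

end

end HV

namespace HV

open Finset Matrix Topology

variable {n : ℕ}

/-! ### Cholesky factors -/

/-! Let `j` precede `i` if `j = i` or `x_j ∈ C_i` (`Precedes`). This is a partial order compatible
with the index order. Since the ancestors of a node are initial segments of one tuple, the
predecessors of an index form a chain. The sparsity claims rest on these two facts.

By the chain rule the density is `∏ p(x_i | C_i)`, that is, `N(μ, (U Uᵀ)⁻¹)`, where column `i` of
`U` is the residual vector of the regression of `x_i` on `C_i`, divided by its standard deviation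
(`hvDensity_eq`). This `U` is upper triangular with positive diagonal and supported on the order. By
uniqueness of Cholesky factors it is the reverse factor of the precision matrix, and the Cholesky
factor of the covariance matrix is the transpose of `U⁻¹`. Conditioning on `y` adds a diagonal
matrix to the precision, and `y` affects only the mean (`hvPosterior_eq`). By the chain property the
nonzero entries of `U Uᵀ` sit at comparable positions; a diagonal term preserves this, and reverse
Cholesky elimination of such a matrix creates no fill-in (`IsRChol.supportedOn`). Inversion
preserves support on a partial order (`SupportedOn.inv`), which settles the lower factors.

For genericity, all entries are analytic in `Σ` on the convex set of positive definite matrices, so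
an entry that is nonzero at one `Σ` is nonzero on an open dense set (`isOpen_dense_ne_zero`). For `j
∈ C_i` such a `Σ` is explicit (`exists_posteriorFactor_ne_zero`). There are finitely many positions
to intersect over, and the prior is the case of zero observation precisions. -/

theorem IsChol.apply_eq {A L : Matrix (Fin n) (Fin n) ℝ} (h : IsChol A L) (i j : Fin n) :
    A i j = ∑ k ∈ Iio j, L i k * L j k + L i j * L j j := by
  have hsum := Finset.sum_insert (s := Iio j) (a := j) (f := fun k => L i k * L j k) (by simp)
  rw [← h.2.2, Matrix.mul_apply, add_comm, ← hsum, Iio_insert]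
  refine (Finset.sum_subset (subset_univ _) fun k _ hk => ?_).symm
  rw [Matrix.transpose_apply, h.1 j k (by simpa using hk), mul_zero]

theorem IsChol.diag_eq {A L : Matrix (Fin n) (Fin n) ℝ} (h : IsChol A L) (j : Fin n) :
    L j j = √(A j j - ∑ k ∈ Iio j, L j k * L j k) := by
  rw [h.apply_eq j j, add_sub_cancel_left, Real.sqrt_mul_self (h.2.1 j).le]

theorem IsChol.entry_eq {A L : Matrix (Fin n) (Fin n) ℝ} (h : IsChol A L) (i j : Fin n) :
    L i j = (A i j - ∑ k ∈ Iio j, L i k * L j k) / L j j := by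
  rw [h.apply_eq i j, add_sub_cancel_left, mul_div_cancel_right₀ _ (h.2.1 j).ne']

/-- Each column is determined by the columns to its left: positivity fixes the root on the diagonal,
and division by it gives the rest. -/
theorem IsChol.unique {A L L' : Matrix (Fin n) (Fin n) ℝ} (h : IsChol A L) (h' : IsChol A L') :
    L = L' := by
  suffices ∀ j i, L i j = L' i j from Matrix.ext fun i j => this j i
  intro j
  induction j using WellFoundedLT.induction with
  | ind j ih =>
    have hd : L j j = L' j j := by
      rw [h.diag_eq, h'.diag_eq]
      congr 2
      exact Finset.sum_congr rfl fun k hk => by rw [ih k (mem_Iio.1 hk)]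
    intro i
    rw [h.entry_eq, h'.entry_eq, hd]
    congr 2
    exact Finset.sum_congr rfl fun k hk => by rw [ih k (mem_Iio.1 hk), ih k (mem_Iio.1 hk)]

theorem IsChol.chol_eq {A L : Matrix (Fin n) (Fin n) ℝ} (h : IsChol A L) : chol A = L := by
  have hex : ∃ L, IsChol A L := ⟨L, h⟩
  rw [chol, dif_pos hex]
  exact hex.choose_spec.unique h

theorem IsChol.isChol_chol {A L : Matrix (Fin n) (Fin n) ℝ} (h : IsChol A L) :
    IsChol A (chol A) := by
  rwa [h.chol_eq]

/-- The entries of Cholesky factors depend analytically on the matrix. -/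
theorem IsChol.analyticAt {E : Type*} [NormedAddCommGroup E] [NormedSpace ℝ E]
    {A L : E → Matrix (Fin n) (Fin n) ℝ} {x : E} (h : ∀ᶠ y in nhds x, IsChol (A y) (L y))
    (hA : ∀ i j, AnalyticAt ℝ (fun y => A y i j) x) (i j : Fin n) :
    AnalyticAt ℝ (fun y => L y i j) x := by
  induction j using WellFoundedLT.induction generalizing i with
  | ind j ih =>
    have hs : ∀ i, AnalyticAt ℝ (fun y => A y i j - ∑ k ∈ Iio j, L y i k * L y j k) x := fun i =>
      (hA i j).sub <| Finset.analyticAt_fun_sum _ fun k hk =>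
        (ih k (mem_Iio.1 hk) i).mul (ih k (mem_Iio.1 hk) j)
    have hd : AnalyticAt ℝ (fun y => L y j j) x := by
      have hx := h.self_of_nhds
      -- The radicand is `L j j ^ 2`, nonzero at `x`, so the square root is analytic there.
      have hne : A x j j - ∑ k ∈ Iio j, L x j k * L x j k ≠ 0 := by
        rw [hx.apply_eq j j, add_sub_cancel_left]
        exact mul_self_ne_zero.2 (hx.2.1 j).ne'
      refine AnalyticAt.congr ?_ (h.mono fun y hy => (hy.diag_eq j).symm)
      exact ContDiffAt.analyticAt ((hs j).contDiffAt.sqrt hne)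
    refine AnalyticAt.congr ((hs i).div hd ?_) (h.mono fun y hy => (hy.entry_eq i j).symm)
    exact (h.self_of_nhds.2.1 j).ne'

/-! ### Matrices supported on an order relation -/

/-- The nonzero entries of `U` are at positions related by `r`. -/
def SupportedOn (r : Fin n → Fin n → Prop) (U : Matrix (Fin n) (Fin n) ℝ) : Prop :=
  ∀ i j, U i j ≠ 0 → r i j

/-- A partial order on the indices which is compatible with the order of the indices. -/
structure IsCompatibleOrder (r : Fin n → Fin n → Prop) : Prop where
  refl : ∀ i, r i i
  trans : ∀ i j k, r i j → r j k → r i k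
  le : ∀ i j, r i j → i ≤ j

/-- With this order the results on supports specialize to upper triangular matrices. -/
theorem isCompatibleOrder_le : IsCompatibleOrder (fun i j : Fin n => i ≤ j) :=
  ⟨le_refl, fun _ _ _ => le_trans, fun _ _ => id⟩

theorem SupportedOn.upper {r : Fin n → Fin n → Prop} (hr : IsCompatibleOrder r)
    {U : Matrix (Fin n) (Fin n) ℝ} (hU : SupportedOn r U) : SupportedOn (· ≤ ·) U :=
  fun i j h => hr.le i j (hU i j h)

theorem SupportedOn.det_eq {U : Matrix (Fin n) (Fin n) ℝ} (hU : SupportedOn (· ≤ ·) U) :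
    U.det = ∏ i, U i i :=
  Matrix.det_of_isUpperTriangular fun i j hij => by
    by_contra h
    exact absurd (hU i j h) (not_le.2 hij)

theorem SupportedOn.det_pos {U : Matrix (Fin n) (Fin n) ℝ} (hU : SupportedOn (· ≤ ·) U)
    (hd : ∀ i, 0 < U i i) : 0 < U.det := by
  rw [hU.det_eq]
  exact Finset.prod_pos fun i _ => hd i

/-- Rows are treated from the last upwards. In `(U * U⁻¹) i j = 0`, a nonzero term with `k ≠ i`
gives `r i k` and, by induction, `r k j`, hence `r i j`. Without `r i j` only `U i i * U⁻¹ i j` is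
left. -/
theorem SupportedOn.inv {r : Fin n → Fin n → Prop} (hr : IsCompatibleOrder r)
    {U : Matrix (Fin n) (Fin n) ℝ} (hU : SupportedOn r U) (hd : ∀ i, 0 < U i i) :
    SupportedOn r U⁻¹ := by
  have hdet := ((hU.upper hr).det_pos hd).ne'
  intro i
  induction i using WellFoundedGT.induction with
  | ind i ih =>
    intro j
    contrapose
    intro hij
    have hne : i ≠ j := fun h => hij (h ▸ hr.refl i)
    have h1 : (U * U⁻¹) i j = 0 := by
      rw [Matrix.mul_nonsing_inv _ (isUnit_iff_ne_zero.2 hdet), Matrix.one_apply_ne hne]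
    rw [Matrix.mul_apply, Finset.sum_eq_single i] at h1
    · exact (mul_eq_zero.1 h1).resolve_left (hd i).ne'
    · intro k _ hk
      by_contra h
      have h2 := hU i k (left_ne_zero_of_mul h)
      exact hij (hr.trans i k j h2
        (ih k (lt_of_le_of_ne (hr.le _ _ h2) hk.symm) j (right_ne_zero_of_mul h)))
    · simp

theorem SupportedOn.inv_diag {U : Matrix (Fin n) (Fin n) ℝ} (hU : SupportedOn (· ≤ ·) U)
    (hd : ∀ i, 0 < U i i) (i : Fin n) : U⁻¹ i i = (U i i)⁻¹ := by
  have h1 : (U * U⁻¹) i i = 1 := by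
    rw [Matrix.mul_nonsing_inv _ (isUnit_iff_ne_zero.2 (hU.det_pos hd).ne'), Matrix.one_apply_eq]
  rw [Matrix.mul_apply, Finset.sum_eq_single i] at h1
  · exact eq_inv_of_mul_eq_one_right h1
  · intro k _ hk
    by_contra h
    exact hk (le_antisymm (hU.inv isCompatibleOrder_le hd k i (right_ne_zero_of_mul h))
      (hU i k (left_ne_zero_of_mul h)))
  · simp

/-! ### Reverse Cholesky factors -/

/-- `U` is a Cholesky factor of `A` under reverse ordering: upper triangular with positive
diagonal and `U Uᵀ = A`. -/
structure IsRChol (A U : Matrix (Fin n) (Fin n) ℝ) : Prop where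
  upper : SupportedOn (· ≤ ·) U
  diag_pos : ∀ i, 0 < U i i
  mul_transpose : U * Uᵀ = A

namespace IsRChol

variable {A U : Matrix (Fin n) (Fin n) ℝ}

theorem isUnit_det (h : IsRChol A U) : IsUnit U.det :=
  isUnit_iff_ne_zero.2 (h.upper.det_pos h.diag_pos).ne'

theorem isChol_reverse (h : IsRChol A U) : IsChol (reverse A) (reverse U) := by
  refine ⟨fun i j hij => ?_, fun i => h.diag_pos _, ?_⟩
  · by_contra hne
    exact absurd (h.upper _ _ hne) (not_le.2 (Fin.rev_lt_rev.2 hij))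
  · rw [← h.mul_transpose]
    exact Matrix.submatrix_mul_equiv U Uᵀ Fin.rev Fin.revPerm Fin.rev

theorem rchol_eq (h : IsRChol A U) : rchol A = U := by
  rw [rchol, h.isChol_reverse.chol_eq, reverse, reverse, Matrix.submatrix_submatrix]
  ext i j
  simp

/-- This reduces the pattern of the covariance factor to that of `U⁻¹`. -/
theorem isChol_inv (h : IsRChol A U) : IsChol A⁻¹ (U⁻¹)ᵀ := by
  refine ⟨fun i j hij => ?_, fun i => ?_, ?_⟩
  · by_contra hne
    exact absurd (h.upper.inv isCompatibleOrder_le h.diag_pos j i hne) (not_le.2 hij)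
  · rw [Matrix.transpose_apply, h.upper.inv_diag h.diag_pos]
    exact inv_pos.2 (h.diag_pos i)
  · rw [← h.mul_transpose, Matrix.mul_inv_rev, Matrix.transpose_transpose,
      Matrix.transpose_nonsing_inv]

theorem chol_inv_eq (h : IsRChol A U) : chol A⁻¹ = (U⁻¹)ᵀ := h.isChol_inv.chol_eq

theorem posDef (h : IsRChol A U) : A.PosDef := by
  have h1 := Matrix.PosDef.mul_conjTranspose_self U (by
    rw [Matrix.vecMul_injective_iff_isUnit, Matrix.isUnit_iff_isUnit_det]
    exact h.isUnit_det)
  rwa [Matrix.conjTranspose_eq_transpose_of_trivial, h.mul_transpose] at h1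

end IsRChol

/-- Let the predecessors of every index form a chain, and let the nonzero entries of `A` be at
comparable positions. Then the reverse Cholesky factor of `A` has no fill-in. -/
theorem IsRChol.supportedOn {r : Fin n → Fin n → Prop} (hr : IsCompatibleOrder r)
    (hchain : ∀ i j k, r i k → r j k → r i j ∨ r j i)
    {A U : Matrix (Fin n) (Fin n) ℝ} (h : IsRChol A U)
    (hA : ∀ i j, A i j ≠ 0 → r i j ∨ r j i) : SupportedOn r U := by
  suffices ∀ j i, U i j ≠ 0 → r i j from fun i j => this j i
  intro j
  induction j using WellFoundedGT.induction with
  | ind j ih =>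
    intro i hij
    have hle := h.upper i j hij
    have hcomp : r i j ∨ r j i := by
      -- In `A i j = ∑ k, U i k * U j k` a nonzero term with `k > j` makes `i` and `j` predecessors
      -- of `k` by induction, hence comparable. So only `U i j * U j j ≠ 0` would remain.
      by_contra hnot
      have h0 : A i j = 0 := by
        by_contra h0
        exact hnot (hA i j h0)
      rw [← h.mul_transpose, Matrix.mul_apply, Finset.sum_eq_single j] at h0
      · exact (mul_ne_zero hij (h.diag_pos j).ne') h0
      · intro k _ hk
        by_contra hne
        have h2 := h.upper j k (right_ne_zero_of_mul hne)
        have h3 := ih k (lt_of_le_of_ne h2 hk.symm)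
        exact hnot (hchain i j k (h3 i (left_ne_zero_of_mul hne))
          (h3 j (right_ne_zero_of_mul hne)))
      · simp
    rcases hcomp with h1 | h1
    · exact h1
    · rw [le_antisymm hle (hr.le _ _ h1)]
      exact hr.refl j

/-- The product `U Uᵀ` has its nonzero entries at comparable positions. -/
theorem SupportedOn.mul_transpose {r : Fin n → Fin n → Prop}
    (hchain : ∀ i j k, r i k → r j k → r i j ∨ r j i)
    {U : Matrix (Fin n) (Fin n) ℝ} (hU : SupportedOn r U) (i j : Fin n)
    (hij : (U * Uᵀ) i j ≠ 0) : r i j ∨ r j i := by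
  obtain ⟨k, -, hk⟩ := Finset.exists_ne_zero_of_sum_ne_zero (Matrix.mul_apply (M := U) ▸ hij)
  exact hchain i j k (hU i k (left_ne_zero_of_mul hk)) (hU j k (right_ne_zero_of_mul hk))

/-! ### Precision matrices of marginals and regression vectors -/

/-- The principal submatrix of `S` with indices in `s`. -/
abbrev sub (S : Matrix (Fin n) (Fin n) ℝ) (s : Finset (Fin n)) : Matrix s s ℝ :=
  S.submatrix (fun i : s => (i : Fin n)) (fun i : s => (i : Fin n))

/-- The inverse of the principal submatrix with indices in `s`, extended by zero. -/
noncomputable def marginalPrecision (S : Matrix (Fin n) (Fin n) ℝ) (s : Finset (Fin n)) :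
    Matrix (Fin n) (Fin n) ℝ :=
  Matrix.of fun k l => if h : k ∈ s ∧ l ∈ s then (sub S s)⁻¹ ⟨k, h.1⟩ ⟨l, h.2⟩ else 0

theorem _root_.Matrix.PosDef.sub {S : Matrix (Fin n) (Fin n) ℝ} (hS : S.PosDef)
    (s : Finset (Fin n)) : (HV.sub S s).PosDef :=
  hS.submatrix Subtype.val_injective

theorem _root_.Matrix.PosDef.apply_comm {ι : Type*} {S : Matrix ι ι ℝ} (hS : S.PosDef)
    (i j : ι) : S i j = S j i := by
  simpa using hS.isHermitian.apply j i

theorem sum_eq_sum_coe (s : Finset (Fin n)) (f : Fin n → ℝ) (hf : ∀ k, k ∉ s → f k = 0) :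
    ∑ k, f k = ∑ k : s, f k := by
  rw [Finset.sum_coe_sort s f]
  exact (Finset.sum_subset (subset_univ _) fun k _ hk => hf k hk).symm

section

variable (S : Matrix (Fin n) (Fin n) ℝ) (s : Finset (Fin n))

theorem marginalPrecision_coe (k l : s) :
    marginalPrecision S s k l = (sub S s)⁻¹ k l := by
  simp [marginalPrecision]

theorem marginalPrecision_left {k : Fin n} (hk : k ∉ s) (l : Fin n) :
    marginalPrecision S s k l = 0 := by
  simp [marginalPrecision, hk]

theorem marginalPrecision_mulVec_apply {k : Fin n} (hk : k ∉ s) (b : Fin n → ℝ) :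
    (marginalPrecision S s *ᵥ b) k = 0 := by
  rw [Matrix.mulVec, dotProduct]
  exact Finset.sum_eq_zero fun l _ => by rw [marginalPrecision_left S s hk, zero_mul]

theorem marginalPrecision_right {l : Fin n} (hl : l ∉ s) (k : Fin n) :
    marginalPrecision S s k l = 0 := by
  simp [marginalPrecision, hl]

end

variable {S : Matrix (Fin n) (Fin n) ℝ}

theorem marginalPrecision_comm (hS : S.PosDef) (s : Finset (Fin n)) (k l : Fin n) :
    marginalPrecision S s k l = marginalPrecision S s l k := by
  by_cases hk : k ∈ s
  · by_cases hl : l ∈ s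
    · rw [marginalPrecision_coe S s ⟨k, hk⟩ ⟨l, hl⟩, marginalPrecision_coe S s ⟨l, hl⟩ ⟨k, hk⟩]
      exact (hS.sub s).inv.apply_comm _ _
    · rw [marginalPrecision_right S s hl, marginalPrecision_left S s hl]
  · rw [marginalPrecision_right S s hk, marginalPrecision_left S s hk]

theorem dotProduct_marginalPrecision (hS : S.PosDef) (s : Finset (Fin n)) (a b : Fin n → ℝ) :
    a ⬝ᵥ (marginalPrecision S s *ᵥ b) = (marginalPrecision S s *ᵥ a) ⬝ᵥ b := by
  have hsymm : (marginalPrecision S s)ᵀ = marginalPrecision S s :=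
    Matrix.ext fun i j => marginalPrecision_comm hS s j i
  rw [Matrix.dotProduct_mulVec, ← Matrix.mulVec_transpose, hsymm]

/-- A matrix supported on `s × s` which inverts `S` there, applied from the left. -/
theorem marginalPrecision_mulVec (hS : S.PosDef) (s : Finset (Fin n)) {a b : Fin n → ℝ}
    (ha : ∀ k, k ∉ s → a k = 0) (hab : ∀ k ∈ s, (S *ᵥ a) k = b k) :
    marginalPrecision S s *ᵥ b = a := by
  have hdet : IsUnit (sub S s).det := isUnit_iff_ne_zero.2 (hS.sub s).det_pos.ne'
  have h1 : sub S s *ᵥ (fun k : s => a k) = fun k : s => b k := by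
    funext k
    rw [← hab k k.2]
    exact (sum_eq_sum_coe s (fun l => S k l * a l) fun l hl => by simp [ha l hl]).symm
  have h2 : (sub S s)⁻¹ *ᵥ (fun k : s => b k) = fun k : s => a k := by
    rw [← h1, Matrix.mulVec_mulVec, Matrix.nonsing_inv_mul _ hdet, Matrix.one_mulVec]
  funext k
  by_cases hk : k ∈ s
  · rw [← congrFun h2 ⟨k, hk⟩]
    refine (sum_eq_sum_coe s (fun l => marginalPrecision S s k l * b l) fun l hl => by
      simp [marginalPrecision_right S s hl]).trans ?_
    exact Finset.sum_congr rfl fun l _ => by rw [marginalPrecision_coe S s ⟨k, hk⟩ l]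
  · rw [ha k hk]
    exact marginalPrecision_mulVec_apply S s hk b

theorem mulVec_marginalPrecision (hS : S.PosDef) (s : Finset (Fin n)) (b : Fin n → ℝ)
    {k : Fin n} (hk : k ∈ s) : (S *ᵥ (marginalPrecision S s *ᵥ b)) k = b k := by
  have hdet : IsUnit (sub S s).det := isUnit_iff_ne_zero.2 (hS.sub s).det_pos.ne'
  have h2 : ∀ l : s, (marginalPrecision S s *ᵥ b) l = ((sub S s)⁻¹ *ᵥ (fun k : s => b k)) l :=
    fun l => (sum_eq_sum_coe s (fun m => marginalPrecision S s l m * b m) fun m hm => by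
      simp [marginalPrecision_right S s hm]).trans
        (Finset.sum_congr rfl fun m _ => by rw [marginalPrecision_coe S s l m])
  have h1 : (S *ᵥ (marginalPrecision S s *ᵥ b)) k =
      (sub S s *ᵥ ((sub S s)⁻¹ *ᵥ (fun k : s => b k))) ⟨k, hk⟩ := by
    refine (sum_eq_sum_coe s (fun l => S k l * (marginalPrecision S s *ᵥ b) l) fun l hl => ?_).trans
      (Finset.sum_congr rfl fun l _ => by rw [h2 l]; rfl)
    rw [marginalPrecision_mulVec_apply S s hl, mul_zero]
  rw [h1, Matrix.mulVec_mulVec, Matrix.mul_nonsing_inv _ hdet, Matrix.one_mulVec]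

variable (S) in
/-- The coefficients of the residual of the regression of the variable `i` on the variables in
`C`. -/
noncomputable def residual (C : Finset (Fin n)) (i : Fin n) : Fin n → ℝ :=
  Pi.single i 1 - marginalPrecision S C *ᵥ S.col i

variable (S) in
/-- The conditional variance of the variable `i` given the variables in `C`. -/
noncomputable def condVar (C : Finset (Fin n)) (i : Fin n) : ℝ :=
  (S *ᵥ residual S C i) i

variable {C : Finset (Fin n)} {i : Fin n}

theorem residual_self (hi : i ∉ C) : residual S C i i = 1 := by
  have : (marginalPrecision S C *ᵥ S.col i) i = 0 :=
      marginalPrecision_mulVec_apply S C hi _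
  simp [residual, this]

theorem residual_eq_zero {k : Fin n} (hki : k ≠ i) (hk : k ∉ C) : residual S C i k = 0 := by
  have : (marginalPrecision S C *ᵥ S.col i) k = 0 :=
      marginalPrecision_mulVec_apply S C hk _
  simp [residual, this, hki]

/-- The normal equations: the residual is uncorrelated with the regressors. -/
theorem mulVec_residual (hS : S.PosDef) {k : Fin n} (hk : k ∈ C) :
    (S *ᵥ residual S C i) k = 0 := by
  rw [residual, Matrix.mulVec_sub, Pi.sub_apply, mulVec_marginalPrecision hS C _ hk]
  simp

/-- Only coordinate `i` contributes: the residual vector lives on `insert i C`, and `S` times it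
vanishes on `C`. As a quadratic form, `condVar` is visibly positive. -/
theorem condVar_eq_dotProduct (hS : S.PosDef) (hi : i ∉ C) :
    condVar S C i = residual S C i ⬝ᵥ (S *ᵥ residual S C i) := by
  rw [dotProduct, Finset.sum_eq_single i, residual_self hi, one_mul, condVar]
  · intro k _ hki
    by_cases hk : k ∈ C
    · rw [mulVec_residual hS hk, mul_zero]
    · rw [residual_eq_zero hki hk, zero_mul]
  · simp

theorem condVar_pos (hS : S.PosDef) (hi : i ∉ C) : 0 < condVar S C i := by
  rw [condVar_eq_dotProduct hS hi]
  have h0 : residual S C i ≠ 0 := fun h => by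
    have := residual_self (S := S) hi
    simp [h] at this
  simpa using hS.dotProduct_mulVec_pos h0

/-- The rank one update of the precision matrix when a variable is added. -/
theorem marginalPrecision_insert_mulVec (hS : S.PosDef) (hi : i ∉ C) (b : Fin n → ℝ) :
    marginalPrecision S (insert i C) *ᵥ b = marginalPrecision S C *ᵥ b +
      ((residual S C i ⬝ᵥ b) / condVar S C i) • residual S C i := by
  have hσ := (condVar_pos hS hi).ne'
  -- The candidate is checked by its support and its image under `S`. On `C` the residual adds
  -- nothing; at `i` its coefficient makes up exactly for the prediction error of `b`.
  apply marginalPrecision_mulVec hS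
  · intro k hk
    rw [Finset.mem_insert, not_or] at hk
    have : (marginalPrecision S C *ᵥ b) k = 0 :=
      marginalPrecision_mulVec_apply S C hk.2 _
    simp [this, residual_eq_zero hk.1 hk.2]
  · intro k hk
    rw [Matrix.mulVec_add, Matrix.mulVec_smul, Pi.add_apply, Pi.smul_apply, smul_eq_mul]
    rcases Finset.mem_insert.1 hk with rfl | hk
    · change _ + _ * condVar S C k = _
      rw [div_mul_cancel₀ _ hσ, residual, sub_dotProduct, single_dotProduct, one_mul,
        ← dotProduct_marginalPrecision hS]
      have hrow : S.col k = S k := funext fun l => hS.apply_comm l k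
      rw [hrow]
      exact add_sub_cancel (S k ⬝ᵥ marginalPrecision S C *ᵥ b) (b k)
    · rw [mulVec_marginalPrecision hS C b hk, mulVec_residual hS hk, mul_zero, add_zero]

/-- The conditional variance is the Schur complement of `sub S C`. -/
theorem det_sub_insert (hS : S.PosDef) (hi : i ∉ C) :
    (sub S (insert i C)).det = (sub S C).det * condVar S C i := by
  let e := (Finset.subtypeInsertEquivOption hi).trans (Equiv.optionEquivSumPUnit.{0} _)
  have hblock : (sub S (insert i C)).submatrix e.symm e.symm = Matrix.fromBlocks (sub S C)
      (Matrix.of fun (k : C) (_ : PUnit) => S k i) (Matrix.of fun (_ : PUnit) (k : C) => S i k)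
      (Matrix.of fun _ _ => S i i) := by
    ext (k | k) (l | l) <;> rfl
  have : Invertible (sub S C) :=
    Matrix.invertibleOfIsUnitDet _ (isUnit_iff_ne_zero.2 (hS.sub C).det_pos.ne')
  rw [← Matrix.det_submatrix_equiv_self e.symm, hblock, Matrix.det_fromBlocks₁₁,
    Matrix.det_unique (n := PUnit), Matrix.invOf_eq_nonsing_inv]
  congr 1
  have h1 : ∀ l : C, (marginalPrecision S C *ᵥ S.col i) l =
      ∑ m : C, (sub S C)⁻¹ l m * S m i := fun l =>
    (sum_eq_sum_coe C (fun m => marginalPrecision S C l m * S m i) fun m hm => by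
      simp [marginalPrecision_right S C hm]).trans
        (Finset.sum_congr rfl fun m _ => by rw [marginalPrecision_coe S C l m])
  rw [condVar, residual, Matrix.mulVec_sub, Pi.sub_apply, Matrix.mul_assoc, Matrix.sub_apply,
    Matrix.mul_apply]
  congr 1
  · simp
  · refine ((sum_eq_sum_coe C (fun l => S i l * (marginalPrecision S C *ᵥ S.col i) l)
      fun l hl => ?_).trans (Finset.sum_congr rfl fun l _ => ?_)).symm
    · rw [marginalPrecision_mulVec_apply S C hl, mul_zero]
    · rw [h1 l, Matrix.mul_apply]
      rfl

/-! ### The order of the hierarchy -/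

namespace Hierarchy

variable {H : Hierarchy n}

theorem IsAncestor.trans {a b c : H.Node} (hab : H.IsAncestor a b) (hbc : H.IsAncestor b c) :
    H.IsAncestor a c := by
  obtain ⟨h1, h1'⟩ := hab
  obtain ⟨h2, h2'⟩ := hbc
  exact ⟨h1.trans h2, fun k => (h2' ⟨k, k.2.trans h1⟩).trans (h1' k)⟩

/-- Of two initial segments of one tuple, the shorter is an initial segment of the longer. This tree
property is what prevents fill-in. -/
theorem IsAncestor.comparable {a b c : H.Node} (ha : H.IsAncestor a c) (hb : H.IsAncestor b c) :
    H.IsAncestor a b ∨ a = b ∨ H.IsAncestor b a := by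
  obtain ⟨h1, h1'⟩ := ha
  obtain ⟨h2, h2'⟩ := hb
  rcases lt_trichotomy (a.1 : ℕ) (b.1 : ℕ) with h | h | h
  · exact Or.inl ⟨h, fun k => (h2' ⟨k, k.2.trans h⟩).symm.trans (h1' k)⟩
  · obtain ⟨a, f⟩ := a
    obtain ⟨b, g⟩ := b
    obtain rfl : a = b := Fin.ext h
    exact Or.inr (Or.inl (congrArg (Sigma.mk a) (funext fun k => (h1' k).symm.trans (h2' k))))
  · exact Or.inr (Or.inr ⟨h, fun k => (h1' ⟨k, k.2.trans h⟩).symm.trans (h2' k)⟩)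

theorem mem_members {a : H.Node} {i : Fin n} : i ∈ H.members a ↔ H.node i = a := by
  simp [members]

theorem mem_ancestors {a : H.Node} {i : Fin n} :
    i ∈ H.ancestors a ↔ H.IsAncestor (H.node i) a := by
  simp [ancestors]

theorem mem_condSet {k i : Fin n} : k ∈ H.condSet i ↔
    H.IsAncestor (H.node k) (H.node i) ∨ H.node k = H.node i ∧ k < i := by
  simp [condSet, mem_members, mem_ancestors]

/-- An ancestor has strictly lower resolution, so the ordering by resolution places it earlier. -/
theorem lt_of_mem_condSet {k i : Fin n} (h : k ∈ H.condSet i) : k < i := by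
  rcases mem_condSet.1 h with ⟨h, -⟩ | h
  · by_contra hle
    rcases eq_or_lt_of_le (not_lt.1 hle) with rfl | hlt
    · exact lt_irrefl _ h
    · exact absurd (H.ordered k i hlt) (not_le.2 h)
  · exact h.2

theorem notMem_condSet_self (i : Fin n) : i ∉ H.condSet i :=
  fun h => lt_irrefl i (lt_of_mem_condSet h)

theorem condSet_trans {i j k : Fin n} (hij : i ∈ H.condSet j) (hjk : j ∈ H.condSet k) :
    i ∈ H.condSet k := by
  rw [mem_condSet] at *
  rcases hij with h1 | ⟨h1, h1'⟩ <;> rcases hjk with h2 | ⟨h2, h2'⟩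
  · exact Or.inl (h1.trans h2)
  · exact Or.inl (h2 ▸ h1)
  · exact Or.inl (h1 ▸ h2)
  · exact Or.inr ⟨h1.trans h2, h1'.trans h2'⟩

/-- The tree property compares distinct nodes; within one node the index order decides. -/
theorem condSet_comparable {i j k : Fin n} (hi : i ∈ H.condSet k) (hj : j ∈ H.condSet k) :
    i = j ∨ i ∈ H.condSet j ∨ j ∈ H.condSet i := by
  have key : H.IsAncestor (H.node i) (H.node j) ∨ H.node i = H.node j ∨
      H.IsAncestor (H.node j) (H.node i) := by
    rw [mem_condSet] at hi hj
    rcases hi with h1 | ⟨h1, -⟩ <;> rcases hj with h2 | ⟨h2, -⟩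
    · exact h1.comparable h2
    · exact Or.inl (h2 ▸ h1)
    · exact Or.inr (Or.inr (h1 ▸ h2))
    · exact Or.inr (Or.inl (h1.trans h2.symm))
  rw [mem_condSet, mem_condSet]
  rcases key with h | h | h
  · exact Or.inr (Or.inl (Or.inl h))
  · rcases lt_trichotomy i j with h' | h' | h'
    · exact Or.inr (Or.inl (Or.inr ⟨h, h'⟩))
    · exact Or.inl h'
    · exact Or.inr (Or.inr (Or.inr ⟨h.symm, h'⟩))
  · exact Or.inr (Or.inr (Or.inl h))

variable (H) in
/-- The order on the indices given by the hierarchy: `j` equals `i` or is in the conditioning set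
of `i`. -/
def Precedes (j i : Fin n) : Prop := j = i ∨ j ∈ H.condSet i

theorem isCompatibleOrder_precedes : IsCompatibleOrder H.Precedes where
  refl _ := Or.inl rfl
  trans i j k := by
    rintro (rfl | h1) (rfl | h2)
    · exact Or.inl rfl
    · exact Or.inr h2
    · exact Or.inr h1
    · exact Or.inr (condSet_trans h1 h2)
  le i j := by
    rintro (rfl | h)
    · exact le_rfl
    · exact (lt_of_mem_condSet h).le

theorem Precedes.comparable {i j k : Fin n} (hi : H.Precedes i k) (hj : H.Precedes j k) :
    H.Precedes i j ∨ H.Precedes j i := by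
  rcases hi with rfl | hi
  · exact Or.inr hj
  · rcases hj with rfl | hj
    · exact Or.inl (Or.inr hi)
    · rcases condSet_comparable hi hj with h | h | h
      · exact Or.inl (Or.inl h)
      · exact Or.inl (Or.inr h)
      · exact Or.inr (Or.inr h)

end Hierarchy

/-! ### Vecchia factors -/

/-- The factor `U` of the precision matrix `U Uᵀ` of the Vecchia approximation
`∏ i, p(x_i | x_{C i})`. -/
noncomputable def vecchiaFactor (C : Fin n → Finset (Fin n)) (S : Matrix (Fin n) (Fin n) ℝ) :
    Matrix (Fin n) (Fin n) ℝ :=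
  Matrix.of fun j i => residual S (C i) i j / √(condVar S (C i) i)

section

variable {C : Fin n → Finset (Fin n)} {S : Matrix (Fin n) (Fin n) ℝ}

theorem vecchiaFactor_support {j i : Fin n} (h : vecchiaFactor C S j i ≠ 0) :
    j = i ∨ j ∈ C i := by
  by_contra hn
  rw [not_or] at hn
  exact h (by simp [vecchiaFactor, residual_eq_zero hn.1 hn.2])

variable (hC : ∀ i, ∀ k ∈ C i, k < i)
include hC

theorem vecchiaFactor_diag (i : Fin n) :
    vecchiaFactor C S i i = (√(condVar S (C i) i))⁻¹ := by
  simp [vecchiaFactor, residual_self fun h => lt_irrefl i (hC i i h)]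

theorem condVar_vecchia_pos (hS : S.PosDef) (i : Fin n) : 0 < condVar S (C i) i :=
  condVar_pos hS fun h => lt_irrefl i (hC i i h)

/-- Assuming only positive conditional variances allows for matrices near a positive definite one
that are not symmetric. -/
theorem isRChol_vecchiaFactor_of_pos (hσ : ∀ i, 0 < condVar S (C i) i) :
    IsRChol (vecchiaFactor C S * (vecchiaFactor C S)ᵀ) (vecchiaFactor C S) where
  upper j i h := (vecchiaFactor_support h).elim (fun h => h.le) fun h => (hC i j h).le
  diag_pos i := by
    rw [vecchiaFactor_diag hC]
    exact inv_pos.2 (Real.sqrt_pos.2 (hσ i))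
  mul_transpose := rfl

theorem isRChol_vecchiaFactor (hS : S.PosDef) :
    IsRChol (vecchiaFactor C S * (vecchiaFactor C S)ᵀ) (vecchiaFactor C S) :=
  isRChol_vecchiaFactor_of_pos hC (condVar_vecchia_pos hC hS)

end

/-- Conditioning on all previous variables is exact. By the normal equations `S * U` is lower
triangular, hence so is `Uᵀ * S * U`. Being symmetric, it is diagonal, and the scaling by standard
deviations makes it the identity. -/
theorem _root_.Matrix.PosDef.exists_isRChol {A : Matrix (Fin n) (Fin n) ℝ} (hA : A.PosDef) :
    ∃ U, IsRChol A U := by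
  have hS : A⁻¹.PosDef := hA.inv
  set S := A⁻¹ with hSdef
  set U := vecchiaFactor (fun i => Iio i) S with hU
  have hC : ∀ i : Fin n, ∀ k ∈ Iio i, k < i := fun i k hk => mem_Iio.1 hk
  have h := isRChol_vecchiaFactor hC hS
  have hcol : ∀ k j, (S * U) k j = (S *ᵥ residual S (Iio j) j) k / √(condVar S (Iio j) j) := by
    intro k j
    rw [Matrix.mul_apply, Matrix.mulVec, dotProduct, Finset.sum_div]
    exact Finset.sum_congr rfl fun l _ => mul_div_assoc' _ _ _
  have hzero : ∀ k j, k < j → (S * U) k j = 0 := fun k j hkj => by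
    rw [hcol, mulVec_residual hS (mem_Iio.2 hkj), zero_div]
  have hdiag : ∀ j, U j j * (S * U) j j = 1 := fun j => by
    have hσ := condVar_vecchia_pos hC hS j
    rw [hcol, hU, vecchiaFactor_diag hC, ← condVar, ← div_eq_inv_mul, div_div,
      Real.mul_self_sqrt hσ.le, div_self hσ.ne']
  have hsymm : (Uᵀ * (S * U))ᵀ = Uᵀ * (S * U) := by
    have hSt : Sᵀ = S := Matrix.ext fun i j => hS.apply_comm j i
    rw [Matrix.transpose_mul, Matrix.transpose_mul, hSt, Matrix.transpose_transpose,
      Matrix.mul_assoc]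
  have hlow : ∀ i j, i < j → (Uᵀ * (S * U)) i j = 0 := fun i j hij => by
    rw [Matrix.mul_apply]
    refine Finset.sum_eq_zero fun k _ => ?_
    by_contra hne
    have h1 := h.upper k i (left_ne_zero_of_mul hne)
    exact right_ne_zero_of_mul hne (hzero k j (lt_of_le_of_lt h1 hij))
  have hone : Uᵀ * (S * U) = 1 := by
    ext i j
    rcases lt_trichotomy i j with hij | rfl | hij
    · rw [hlow i j hij, Matrix.one_apply_ne hij.ne]
    · rw [Matrix.one_apply_eq, ← hdiag i, Matrix.mul_apply, Finset.sum_eq_single i]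
      · rfl
      · intro k _ hk
        by_contra hne
        have h1 := h.upper k i (left_ne_zero_of_mul hne)
        exact right_ne_zero_of_mul hne (hzero k i (lt_of_le_of_ne h1 hk))
      · simp
    · rw [← hsymm, Matrix.transpose_apply, hlow j i hij, Matrix.one_apply_ne hij.ne']
  have hAdet : IsUnit A.det := isUnit_iff_ne_zero.2 hA.det_pos.ne'
  have hinv : U * Uᵀ = A := by
    have h1 : S * U * Uᵀ = 1 := mul_eq_one_comm.1 hone
    have h2 : A * S = 1 := Matrix.mul_nonsing_inv _ hAdet
    calc U * Uᵀ = A * S * U * Uᵀ := by rw [h2, Matrix.one_mul]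
      _ = A * (S * U * Uᵀ) := by simp only [Matrix.mul_assoc]
      _ = A := by rw [h1, Matrix.mul_one]
  exact ⟨U, h.upper, h.diag_pos, hinv⟩

/-- The Vecchia factor recovers an upper triangular factor with the corresponding support. -/
theorem vecchiaFactor_eq {C : Fin n → Finset (Fin n)} (hC : ∀ i, ∀ k ∈ C i, k < i)
    {A U : Matrix (Fin n) (Fin n) ℝ} (h : IsRChol A U)
    (hU : ∀ j i, U j i ≠ 0 → j = i ∨ j ∈ C i) : vecchiaFactor C A⁻¹ = U := by
  have hS : A⁻¹.PosDef := h.posDef.inv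
  have hSU : A⁻¹ * U = (U⁻¹)ᵀ := by
    have h1 : Uᵀ * (U⁻¹)ᵀ = 1 := by
      rw [← Matrix.transpose_mul, Matrix.nonsing_inv_mul _ h.isUnit_det, Matrix.transpose_one]
    calc A⁻¹ * U = A⁻¹ * (U * (Uᵀ * (U⁻¹)ᵀ)) := by rw [h1, Matrix.mul_one]
      _ = A⁻¹ * (U * Uᵀ) * (U⁻¹)ᵀ := by simp only [Matrix.mul_assoc]
      _ = (U⁻¹)ᵀ := by
        rw [h.mul_transpose, Matrix.nonsing_inv_mul _ (isUnit_iff_ne_zero.2 h.posDef.det_pos.ne'),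
          Matrix.one_mul]
  have hSU0 : ∀ k i, k < i → (A⁻¹ * U) k i = 0 := fun k i hki => by
    rw [hSU]
    by_contra hne
    exact absurd (h.upper.inv isCompatibleOrder_le h.diag_pos i k hne) (not_le.2 hki)
  -- Since `A⁻¹ * U` is lower triangular, column `i` of `U`, scaled to have entry `1` at `i`,
  -- satisfies the normal equations on `C i`.
  have hres : ∀ i, residual A⁻¹ (C i) i = fun j => U j i / U i i := by
    intro i
    have hii := (h.diag_pos i).ne'
    have hm : marginalPrecision A⁻¹ (C i) *ᵥ A⁻¹.col i =
        Pi.single i 1 - fun j => U j i / U i i := by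
      apply marginalPrecision_mulVec hS
      · intro k hk
        by_cases hki : k = i
        · subst hki
          simp [hii]
        · have : U k i = 0 := by
            by_contra hne
            exact (hU k i hne).elim hki hk
          simp [hki, this]
      · intro k hk
        have h0 : (A⁻¹ *ᵥ fun j => U j i / U i i) k = 0 := by
          have : (A⁻¹ *ᵥ fun j => U j i / U i i) k = (A⁻¹ * U) k i / U i i := by
            rw [Matrix.mul_apply, Matrix.mulVec, dotProduct, Finset.sum_div]
            exact Finset.sum_congr rfl fun l _ => mul_div_assoc' _ _ _
          rw [this, hSU0 k i (hC i k hk), zero_div]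
        rw [Matrix.mulVec_sub, Pi.sub_apply, h0]
        simp
    rw [residual, hm, sub_sub_cancel]
  have hvar : ∀ i, condVar A⁻¹ (C i) i = (U i i)⁻¹ ^ 2 := by
    intro i
    have : (A⁻¹ *ᵥ fun j => U j i / U i i) i = (A⁻¹ * U) i i / U i i := by
      rw [Matrix.mul_apply, Matrix.mulVec, dotProduct, Finset.sum_div]
      exact Finset.sum_congr rfl fun l _ => mul_div_assoc' _ _ _
    rw [condVar, hres, this, hSU, Matrix.transpose_apply, h.upper.inv_diag h.diag_pos, sq,
      div_eq_mul_inv]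
  ext j i
  have hii := h.diag_pos i
  rw [vecchiaFactor, Matrix.of_apply, hres, hvar, Real.sqrt_sq (inv_pos.2 hii).le, div_inv_eq_mul,
    div_mul_cancel₀ _ hii.ne']

/-! ### The density of the hierarchical Vecchia approximation -/

/-- The density of the normal distribution with mean `m` and precision matrix `U Uᵀ`. -/
noncomputable def precisionDensity (m : Fin n → ℝ) (U : Matrix (Fin n) (Fin n) ℝ)
    (x : Fin n → ℝ) : ℝ :=
  U.det * ∏ i, gaussianPDFReal 0 1 ((Uᵀ *ᵥ (x - m)) i)

/-- Extension by zero puts the quadratic forms of all index sets on one space, so that those of `C`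
and `insert i C` can be compared. -/
theorem subDensity_eq (μ : Fin n → ℝ) (S : Matrix (Fin n) (Fin n) ℝ) (s : Finset (Fin n))
    (x : Fin n → ℝ) : subDensity μ S s x = (√((2 * Real.pi) ^ #s * (sub S s).det))⁻¹ *
      Real.exp (-(1 / 2) * ((x - μ) ⬝ᵥ (marginalPrecision S s *ᵥ (x - μ)))) := by
  rw [subDensity, gaussianDensity, Fintype.card_coe]
  congr 3
  symm
  refine (sum_eq_sum_coe s (fun k => (x - μ) k * (marginalPrecision S s *ᵥ (x - μ)) k)
    fun k hk => ?_).trans (Finset.sum_congr rfl fun k _ => ?_)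
  · rw [marginalPrecision_mulVec_apply S s hk, mul_zero]
  · congr 1
    refine (sum_eq_sum_coe s (fun l => marginalPrecision S s k l * (x - μ) l)
      fun l hl => ?_).trans (Finset.sum_congr rfl fun l _ => ?_)
    · rw [marginalPrecision_right S s hl, zero_mul]
    · rw [marginalPrecision_coe S s k l]
      rfl

theorem subDensity_pos (μ : Fin n → ℝ) {S : Matrix (Fin n) (Fin n) ℝ} (hS : S.PosDef)
    (s : Finset (Fin n)) (x : Fin n → ℝ) : 0 < subDensity μ S s x := by
  have := (hS.sub s).det_pos
  rw [subDensity_eq]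
  positivity

theorem gaussianPDFReal_zero_one (z : ℝ) :
    gaussianPDFReal 0 1 z = (√(2 * Real.pi))⁻¹ * Real.exp (-(1 / 2) * z ^ 2) := by
  rw [gaussianPDFReal]
  simp only [NNReal.coe_one, mul_one, sub_zero]
  congr 2
  ring

/-- The rank one update makes the quadratic forms differ by one square, and the determinants have
ratio `condVar S C i`. -/
theorem subDensity_insert_div (μ : Fin n → ℝ) {S : Matrix (Fin n) (Fin n) ℝ} (hS : S.PosDef)
    {C : Finset (Fin n)} {i : Fin n} (hi : i ∉ C) (x : Fin n → ℝ) :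
    subDensity μ S (insert i C) x / subDensity μ S C x =
      (√(condVar S C i))⁻¹ *
        gaussianPDFReal 0 1 ((residual S C i ⬝ᵥ (x - μ)) / √(condVar S C i)) := by
  have hσ := condVar_pos hS hi
  have hdet := (hS.sub C).det_pos
  set d := x - μ with hd
  have hquad : d ⬝ᵥ (marginalPrecision S (insert i C) *ᵥ d) =
      d ⬝ᵥ (marginalPrecision S C *ᵥ d) + ((residual S C i ⬝ᵥ d) / √(condVar S C i)) ^ 2 := by
    rw [marginalPrecision_insert_mulVec hS hi, dotProduct_add, dotProduct_smul, smul_eq_mul,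
      div_pow, Real.sq_sqrt hσ.le, dotProduct_comm d (residual S C i)]
    ring
  have hroot : √((2 * Real.pi) ^ #(insert i C) * (sub S (insert i C)).det) =
      √((2 * Real.pi) ^ #C * (sub S C).det) * (√(2 * Real.pi) * √(condVar S C i)) := by
    rw [Finset.card_insert_of_notMem hi, det_sub_insert hS hi, ← Real.sqrt_mul (by positivity),
      ← Real.sqrt_mul (by positivity)]
    congr 1
    ring
  rw [subDensity_eq, subDensity_eq, ← hd, hquad, hroot, mul_add, Real.exp_add,
    gaussianPDFReal_zero_one]
  have h1 : √((2 * Real.pi) ^ #C * (sub S C).det) ≠ 0 := by positivity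
  have h2 : √(condVar S C i) ≠ 0 := by positivity
  have h3 : √(2 * Real.pi) ≠ 0 := by positivity
  field_simp

/-- The chain rule: a joint conditional density is the product of the conditional densities of
the single variables. -/
theorem prod_insert_div {f : Finset (Fin n) → ℝ} (hf : ∀ s, f s ≠ 0) (A s : Finset (Fin n)) :
    f (A ∪ s) / f A =
      ∏ i ∈ s, f (insert i (A ∪ {k ∈ s | k < i})) / f (A ∪ {k ∈ s | k < i}) := by
  -- Adding a new maximum leaves the sets of earlier elements unchanged, so the product telescopes.
  induction s using Finset.induction_on_max with
  | empty => simp [hf]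
  | insert a s hlt ih =>
    have ha : a ∉ s := fun h => lt_irrefl a (hlt a h)
    have h1 : {k ∈ insert a s | k < a} = s := by
      ext k
      simp only [Finset.mem_filter, Finset.mem_insert]
      exact ⟨fun h => h.1.resolve_left h.2.ne, fun h => ⟨Or.inr h, hlt k h⟩⟩
    have h2 : ∀ i ∈ s, {k ∈ insert a s | k < i} = {k ∈ s | k < i} := fun i hi => by
      rw [Finset.filter_insert, if_neg (not_lt.2 (hlt i hi).le)]
    rw [Finset.prod_insert ha, h1, Finset.prod_congr rfl fun i hi => by rw [h2 i hi], ← ih,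
      Finset.union_insert, div_mul_div_cancel₀ (hf _)]

/-- For a variable of node `a`, the ancestors of `a` with the earlier members of `a` are its
conditioning set. The chain rule applies in each node, and empty nodes contribute `1`. -/
theorem hvDensity_eq_prod (H : Hierarchy n) (μ : Fin n → ℝ) {S : Matrix (Fin n) (Fin n) ℝ}
    (hS : S.PosDef) (x : Fin n → ℝ) : hvDensity H μ S x =
      ∏ i, subDensity μ S (insert i (H.condSet i)) x / subDensity μ S (H.condSet i) x := by
  classical
  have hnode : ∀ a : H.Node, condDensity μ S (H.members a) (H.ancestors a) x =
      ∏ i ∈ {i | H.node i = a},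
        subDensity μ S (insert i (H.condSet i)) x / subDensity μ S (H.condSet i) x := by
    intro a
    have hm : H.members a = ({i | H.node i = a} : Finset (Fin n)) := by
      ext i
      simp [Hierarchy.mem_members]
    rw [condDensity, Finset.union_comm,
      prod_insert_div (f := fun s => subDensity μ S s x) fun s => (subDensity_pos μ hS s x).ne', hm]
    refine Finset.prod_congr rfl fun i hi => ?_
    have hC : H.ancestors a ∪ {k ∈ ({i | H.node i = a} : Finset (Fin n)) | k < i} =
        H.condSet i := by
      ext k
      simp [Hierarchy.mem_condSet, Hierarchy.mem_ancestors, (Finset.mem_filter.1 hi).2]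
    rw [hC]
  rw [hvDensity, Finset.prod_congr rfl fun a _ => hnode a]
  exact Finset.prod_fiberwise _ _ _

theorem hvDensity_eq (H : Hierarchy n) (μ : Fin n → ℝ) {S : Matrix (Fin n) (Fin n) ℝ}
    (hS : S.PosDef) : hvDensity H μ S = precisionDensity μ (vecchiaFactor H.condSet S) := by
  have hC : ∀ i, ∀ k ∈ H.condSet i, k < i := fun i k hk => Hierarchy.lt_of_mem_condSet hk
  funext x
  rw [hvDensity_eq_prod H μ hS, precisionDensity, (isRChol_vecchiaFactor hC hS).upper.det_eq,
    ← Finset.prod_mul_distrib]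
  refine Finset.prod_congr rfl fun i _ => ?_
  rw [subDensity_insert_div μ hS (Hierarchy.notMem_condSet_self i), vecchiaFactor_diag hC]
  congr 2
  rw [Matrix.mulVec, dotProduct, dotProduct, Finset.sum_div]
  exact Finset.sum_congr rfl fun k _ => mul_div_right_comm _ _ _

/-! ### Gaussian measures given by a factor of the precision matrix -/

theorem precisionDensity_eq (m : Fin n → ℝ) {A U : Matrix (Fin n) (Fin n) ℝ} (h : IsRChol A U)
    (x : Fin n → ℝ) : precisionDensity m U x = U.det * (√(2 * Real.pi))⁻¹ ^ n *
      Real.exp (-(1 / 2) * ((x - m) ⬝ᵥ (A *ᵥ (x - m)))) := by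
  have hquad : (x - m) ⬝ᵥ (A *ᵥ (x - m)) = ∑ i, (Uᵀ *ᵥ (x - m)) i ^ 2 := by
    rw [← h.mul_transpose, ← Matrix.mulVec_mulVec, Matrix.dotProduct_mulVec,
      ← Matrix.mulVec_transpose]
    exact Finset.sum_congr rfl fun i _ => (sq _).symm
  rw [precisionDensity, hquad, Finset.prod_congr rfl fun i _ => gaussianPDFReal_zero_one _,
    Finset.prod_mul_distrib, Finset.prod_const, Finset.card_univ, Fintype.card_fin,
    ← Real.exp_sum, Finset.mul_sum, mul_assoc]

theorem precisionDensity_pos (m : Fin n → ℝ) {A U : Matrix (Fin n) (Fin n) ℝ} (h : IsRChol A U)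
    (x : Fin n → ℝ) : 0 < precisionDensity m U x := by
  have := h.upper.det_pos h.diag_pos
  rw [precisionDensity_eq m h]
  positivity

theorem continuous_precisionDensity (m : Fin n → ℝ) {A U : Matrix (Fin n) (Fin n) ℝ}
    (h : IsRChol A U) : Continuous (precisionDensity m U) := by
  rw [funext fun x => precisionDensity_eq m h x]
  fun_prop

theorem pi_gaussianReal_eq_withDensity :
    Measure.pi (fun _ : Fin n => gaussianReal 0 1) =
      volume.withDensity fun z => ENNReal.ofReal (∏ i, gaussianPDFReal 0 1 (z i)) := by
  refine Measure.pi_eq fun s hs => ?_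
  rw [withDensity_apply _ (MeasurableSet.univ_pi hs), volume_pi, Measure.restrict_pi_pi]
  have hint : ∀ i, Integrable (gaussianPDFReal 0 1) (volume.restrict (s i)) := fun i =>
    (integrable_gaussianPDFReal 0 1).restrict
  rw [← ofReal_integral_eq_lintegral_ofReal (Integrable.fintype_prod fun i => hint i)
      (Filter.Eventually.of_forall fun z => Finset.prod_nonneg fun i _ =>
        gaussianPDFReal_nonneg _ _ _),
    integral_fintype_prod_eq_prod (fun _ : Fin n => gaussianPDFReal 0 1),
    ENNReal.ofReal_prod_of_nonneg fun i _ => integral_nonneg (gaussianPDFReal_nonneg _ _)]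
  refine Finset.prod_congr rfl fun i _ => ?_
  rw [gaussianReal_apply_eq_integral 0 one_ne_zero]

/-- Change of variables `z = Uᵀ (x - m)`: the Jacobian is the factor `U.det` of the density.
Normalization and moments thus reduce to independent standard normals. -/
theorem withDensity_precisionDensity (m : Fin n → ℝ) {A U : Matrix (Fin n) (Fin n) ℝ}
    (h : IsRChol A U) :
    (volume.withDensity fun x => ENNReal.ofReal (precisionDensity m U x)) =
      (Measure.pi fun _ : Fin n => gaussianReal 0 1).map fun z => m + (U⁻¹)ᵀ *ᵥ z := by
  have hdet := h.upper.det_pos h.diag_pos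
  have hcont : Continuous fun z : Fin n → ℝ => m + (U⁻¹)ᵀ *ᵥ z := by fun_prop
  have hinv : ∀ x, m + (U⁻¹)ᵀ *ᵥ (Uᵀ *ᵥ (x - m)) = x := fun x => by
    rw [Matrix.mulVec_mulVec, ← Matrix.transpose_mul, Matrix.mul_nonsing_inv _ h.isUnit_det,
      Matrix.transpose_one, Matrix.one_mulVec, add_sub_cancel]
  have hmap : Measure.map (fun x : Fin n → ℝ => Uᵀ *ᵥ (x - m)) volume =
      ENNReal.ofReal (U.det)⁻¹ • volume := by
    have h1 : (fun x : Fin n → ℝ => Uᵀ *ᵥ (x - m)) =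
        (Matrix.toLin' Uᵀ) ∘ fun x => x - m := rfl
    rw [h1, ← Measure.map_map (by fun_prop) (by fun_prop),
      (measurePreserving_sub_right volume m).map_eq,
      Real.map_matrix_volume_pi_eq_smul_volume_pi (by rw [Matrix.det_transpose]; exact hdet.ne'),
      Matrix.det_transpose, abs_of_pos (inv_pos.2 hdet)]
  ext s hs
  have hpre := hcont.measurable hs
  set g : (Fin n → ℝ) → ENNReal := fun z => ENNReal.ofReal (∏ i, gaussianPDFReal 0 1 (z i)) with hg
  have hgm : Measurable g := by
    refine ENNReal.measurable_ofReal.comp (Finset.measurable_prod _ fun i _ => ?_)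
    exact (measurable_gaussianPDFReal 0 1).comp (measurable_pi_apply i)
  rw [Measure.map_apply hcont.measurable hs, pi_gaussianReal_eq_withDensity,
    withDensity_apply _ hs, withDensity_apply _ hpre, ← lintegral_indicator hs,
    ← lintegral_indicator hpre]
  set F := ((fun z => m + (U⁻¹)ᵀ *ᵥ z) ⁻¹' s).indicator g with hF
  have hFm : Measurable F := hgm.indicator hpre
  have hpt : ∀ x, s.indicator (fun x => ENNReal.ofReal (precisionDensity m U x)) x =
      ENNReal.ofReal U.det * F (Uᵀ *ᵥ (x - m)) := fun x => by
    by_cases hx : x ∈ s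
    · rw [hF, Set.indicator_of_mem hx, Set.indicator_of_mem (by rwa [Set.mem_preimage, hinv]),
        precisionDensity, ENNReal.ofReal_mul hdet.le]
    · rw [hF, Set.indicator_of_notMem hx, Set.indicator_of_notMem (by rwa [Set.mem_preimage, hinv]),
        mul_zero]
  have hT : Measurable fun x : Fin n → ℝ => Uᵀ *ᵥ (x - m) :=
    Continuous.measurable (by fun_prop)
  rw [lintegral_congr hpt,
    lintegral_const_mul (ENNReal.ofReal U.det) (f := fun x => F (Uᵀ *ᵥ (x - m))) (hFm.comp hT),
    ← lintegral_map hFm hT, hmap, lintegral_smul_measure, smul_eq_mul, ← mul_assoc,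
    ← ENNReal.ofReal_mul hdet.le, mul_inv_cancel₀ hdet.ne', ENNReal.ofReal_one, one_mul]

section

variable (m : Fin n → ℝ) {A U : Matrix (Fin n) (Fin n) ℝ} (h : IsRChol A U)
include h

theorem isProbabilityMeasure_precisionDensity :
    IsProbabilityMeasure (volume.withDensity fun x => ENNReal.ofReal (precisionDensity m U x)) := by
  rw [withDensity_precisionDensity m h]
  exact Measure.isProbabilityMeasure_map (by fun_prop)

theorem integral_precisionDensity : ∫ x, precisionDensity m U x = 1 := by
  have h1 := (isProbabilityMeasure_precisionDensity m h).measure_univ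
  rw [withDensity_apply _ MeasurableSet.univ, Measure.restrict_univ] at h1
  rw [integral_eq_lintegral_of_nonneg_ae
    (Filter.Eventually.of_forall fun x => (precisionDensity_pos m h x).le)
    (continuous_precisionDensity m h).aestronglyMeasurable, h1, ENNReal.toReal_one]

omit h in
theorem memLp_eval_pi_gaussianReal (k : Fin n) :
    MemLp (fun z : Fin n → ℝ => z k) 2 (Measure.pi fun _ : Fin n => gaussianReal 0 1) :=
  (memLp_id_gaussianReal 2).comp_measurePreserving (measurePreserving_eval _ k)

omit h in
theorem covariance_eval_pi_gaussianReal (k l : Fin n) :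
    covariance (fun z : Fin n → ℝ => z k) (fun z => z l)
      (Measure.pi fun _ : Fin n => gaussianReal 0 1) = if k = l then 1 else 0 := by
  have hvar : ∀ k, covariance (fun z : Fin n → ℝ => z k) (fun z => z k)
      (Measure.pi fun _ : Fin n => gaussianReal 0 1) = 1 := fun k => by
    have hmap := (measurePreserving_eval (fun _ : Fin n => gaussianReal 0 1) k).map_eq
    have hv := variance_id_gaussianReal (μ := 0) (v := 1)
    rw [← hmap, variance_map aemeasurable_id (measurable_pi_apply k).aemeasurable] at hv
    rw [covariance_self (measurable_pi_apply k).aemeasurable]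
    simpa using hv
  split_ifs with hkl
  · subst hkl
    exact hvar k
  · have hind := iIndepFun_pi (μ := fun _ : Fin n => gaussianReal 0 1) (X := fun _ => id)
      fun _ => aemeasurable_id
    exact (hind.indepFun hkl).covariance_eq_zero (memLp_eval_pi_gaussianReal k)
      (memLp_eval_pi_gaussianReal l)

theorem memLp_precisionDensity (i : Fin n) : MemLp (fun x : Fin n → ℝ => x i) 2
    (volume.withDensity fun x => ENNReal.ofReal (precisionDensity m U x)) := by
  rw [withDensity_precisionDensity m h]
  refine (memLp_map_measure_iff (g := fun x : Fin n → ℝ => x i)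
    (measurable_pi_apply i).aestronglyMeasurable (by fun_prop)).2 ?_
  refine (memLp_const (m i)).add ?_
  exact memLp_finsetSum (f := fun k (z : Fin n → ℝ) => (U⁻¹)ᵀ i k * z k) univ
    fun k _ => (memLp_eval_pi_gaussianReal k).const_mul _

theorem covMatrix_precisionDensity :
    covMatrix (volume.withDensity fun x => ENNReal.ofReal (precisionDensity m U x)) = A⁻¹ := by
  have hinv : A⁻¹ = (U⁻¹)ᵀ * ((U⁻¹)ᵀ)ᵀ := h.isChol_inv.2.2.symm
  ext i j
  have hL : ∀ i k, MemLp (fun z : Fin n → ℝ => (U⁻¹)ᵀ i k * z k) 2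
      (Measure.pi fun _ : Fin n => gaussianReal 0 1) :=
    fun i k => (memLp_eval_pi_gaussianReal k).const_mul _
  have hint : ∀ i, Integrable (fun z : Fin n → ℝ => ∑ k, (U⁻¹)ᵀ i k * z k)
      (Measure.pi fun _ : Fin n => gaussianReal 0 1) := fun i =>
    (memLp_finsetSum _ fun k _ => hL i k).integrable one_le_two
  rw [covMatrix, Matrix.of_apply, withDensity_precisionDensity m h,
    covariance_map_fun (measurable_pi_apply i).aestronglyMeasurable
      (measurable_pi_apply j).aestronglyMeasurable (by fun_prop)]
  change covariance (fun z : Fin n → ℝ => m i + ∑ k, (U⁻¹)ᵀ i k * z k)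
    (fun z : Fin n → ℝ => m j + ∑ k, (U⁻¹)ᵀ j k * z k) _ = _
  rw [covariance_const_add_left (hint i), covariance_const_add_right (hint j),
    covariance_fun_sum_fun_sum (hL i) (hL j), hinv, Matrix.mul_apply]
  refine Finset.sum_congr rfl fun k _ => ?_
  rw [Finset.sum_eq_single k]
  · rw [covariance_const_mul_left, covariance_const_mul_right, covariance_eval_pi_gaussianReal,
      if_pos rfl, mul_one]
    rfl
  · intro l _ hl
    rw [covariance_const_mul_left, covariance_const_mul_right, covariance_eval_pi_gaussianReal,
      if_neg hl.symm, mul_zero, mul_zero]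
  · simp

theorem wellDefined_precisionDensity :
    WellDefined (volume.withDensity fun x => ENNReal.ofReal (precisionDensity m U x)) := by
  refine ⟨isProbabilityMeasure_precisionDensity m h, memLp_precisionDensity m h, ?_⟩
  rw [covMatrix_precisionDensity m h,
    Matrix.nonsing_inv_nonsing_inv _ (isUnit_iff_ne_zero.2 h.posDef.det_pos.ne')]
  exact ⟨h.posDef.inv, h.isChol_inv.isChol_chol, h.isChol_reverse.isChol_chol⟩

end

/-! ### The posterior distribution -/

/-- The precisions of the observations, zero for variables which are not observed. -/
noncomputable def obsPrecision (I : Finset (Fin n)) (τ : I → ℝ) (i : Fin n) : ℝ :=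
  if h : i ∈ I then (τ ⟨i, h⟩ ^ 2)⁻¹ else 0

theorem obsPrecision_nonneg (I : Finset (Fin n)) (τ : I → ℝ) (i : Fin n) :
    0 ≤ obsPrecision I τ i := by
  rw [obsPrecision]
  split_ifs <;> positivity

theorem likelihood_eq (I : Finset (Fin n)) (τ : I → ℝ) (hτ : ∀ i, 0 < τ i) (y : I → ℝ) :
    ∃ c : ℝ, 0 < c ∧ ∃ z : Fin n → ℝ, ∀ x, likelihood I τ y x =
      c * Real.exp (-(1 / 2) * ((x - z) ⬝ᵥ (diagonal (obsPrecision I τ) *ᵥ (x - z)))) := by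
  -- The centre is set to zero where nothing is observed; the precision vanishes there, so any value
  -- would do.
  refine ⟨∏ i : I, (√(2 * Real.pi * τ i ^ 2))⁻¹, Finset.prod_pos fun i _ => ?_,
    fun i => if h : i ∈ I then y ⟨i, h⟩ else 0, fun x => ?_⟩
  · have := hτ i
    positivity
  · rw [likelihood, dotProduct, sum_eq_sum_coe I, Finset.mul_sum, Real.exp_sum,
      ← Finset.prod_mul_distrib]
    · refine Finset.prod_congr rfl fun i _ => ?_
      rw [gaussianPDFReal, Real.coe_toNNReal _ (sq_nonneg _), Matrix.mulVec_diagonal]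
      simp only [Pi.sub_apply, obsPrecision, Finset.coe_mem, dite_true, Subtype.coe_eta]
      congr 2
      have := (hτ i).ne'
      field_simp
      ring
    · intro k hk
      rw [Matrix.mulVec_diagonal, obsPrecision, dif_neg hk, zero_mul, mul_zero]

/-- Completing the square. -/
theorem quadratic_add_quadratic {A D : Matrix (Fin n) (Fin n) ℝ} (hA : Aᵀ = A) (hD : Dᵀ = D)
    (hAD : IsUnit (A + D).det) (a b : Fin n → ℝ) : ∃ (m : Fin n → ℝ) (c : ℝ), ∀ x,
      (x - a) ⬝ᵥ (A *ᵥ (x - a)) + (x - b) ⬝ᵥ (D *ᵥ (x - b)) =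
        (x - m) ⬝ᵥ ((A + D) *ᵥ (x - m)) + c := by
  -- The precision-weighted mean is the stationary point of the sum, so the terms linear in `x - m`
  -- cancel (`hmid`).
  set m := (A + D)⁻¹ *ᵥ (A *ᵥ a + D *ᵥ b) with hm
  have hmid : A *ᵥ (m - a) + D *ᵥ (m - b) = 0 := by
    have : (A + D) *ᵥ m = A *ᵥ a + D *ᵥ b := by
      rw [hm, Matrix.mulVec_mulVec, Matrix.mul_nonsing_inv _ hAD, Matrix.one_mulVec]
    rw [Matrix.mulVec_sub, Matrix.mulVec_sub, ← add_sub_add_comm, ← Matrix.add_mulVec, this,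
      sub_self]
  have hexp : ∀ {B : Matrix (Fin n) (Fin n) ℝ}, Bᵀ = B → ∀ w v : Fin n → ℝ,
      (w + v) ⬝ᵥ (B *ᵥ (w + v)) = w ⬝ᵥ (B *ᵥ w) + 2 * (w ⬝ᵥ (B *ᵥ v)) + v ⬝ᵥ (B *ᵥ v) := by
    intro B hB w v
    have : v ⬝ᵥ (B *ᵥ w) = w ⬝ᵥ (B *ᵥ v) := by
      rw [Matrix.dotProduct_mulVec, ← Matrix.mulVec_transpose, hB, dotProduct_comm]
    rw [Matrix.mulVec_add, dotProduct_add, add_dotProduct, add_dotProduct, this]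
    ring
  refine ⟨m, (m - a) ⬝ᵥ (A *ᵥ (m - a)) + (m - b) ⬝ᵥ (D *ᵥ (m - b)), fun x => ?_⟩
  have hlin : (x - m) ⬝ᵥ (A *ᵥ (m - a)) + (x - m) ⬝ᵥ (D *ᵥ (m - b)) = 0 := by
    rw [← dotProduct_add, hmid, dotProduct_zero]
  rw [← sub_add_sub_cancel x m a, ← sub_add_sub_cancel x m b, hexp hA, hexp hD,
    Matrix.add_mulVec, dotProduct_add]
  linear_combination 2 * hlin

/-- The precision matrix of the posterior distribution if the observations have precisions `d`. -/
noncomputable def posteriorPrecision (H : Hierarchy n) (d : Fin n → ℝ)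
    (S : Matrix (Fin n) (Fin n) ℝ) : Matrix (Fin n) (Fin n) ℝ :=
  vecchiaFactor H.condSet S * (vecchiaFactor H.condSet S)ᵀ + diagonal d

theorem posteriorPrecision_zero (H : Hierarchy n) (S : Matrix (Fin n) (Fin n) ℝ) :
    posteriorPrecision H 0 S = vecchiaFactor H.condSet S * (vecchiaFactor H.condSet S)ᵀ := by
  simp [posteriorPrecision]

theorem IsRChol.posDef_add_diagonal {A U : Matrix (Fin n) (Fin n) ℝ} (h : IsRChol A U)
    {d : Fin n → ℝ} (hd : ∀ i, 0 ≤ d i) : (A + diagonal d).PosDef :=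
  h.posDef.add_posSemidef (Matrix.PosSemidef.diagonal hd)

theorem hvPrior_eq (H : Hierarchy n) (μ : Fin n → ℝ) {S : Matrix (Fin n) (Fin n) ℝ}
    (hS : S.PosDef) : hvPrior H μ S = volume.withDensity fun x =>
      ENNReal.ofReal (precisionDensity μ (vecchiaFactor H.condSet S) x) := by
  rw [hvPrior, hvDensity_eq H μ hS]

theorem isRChol_hvFactor (H : Hierarchy n) {S : Matrix (Fin n) (Fin n) ℝ} (hS : S.PosDef) :
    IsRChol (vecchiaFactor H.condSet S * (vecchiaFactor H.condSet S)ᵀ)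
      (vecchiaFactor H.condSet S) :=
  isRChol_vecchiaFactor (fun _ _ hk => Hierarchy.lt_of_mem_condSet hk) hS

/-- Completing the square turns prior times likelihood into a constant times a normal density, and
Bayes' normalization removes the constant. The factor `V` does not involve `y`. -/
theorem hvPosterior_eq (H : Hierarchy n) (μ : Fin n → ℝ) {S : Matrix (Fin n) (Fin n) ℝ}
    (hS : S.PosDef) (I : Finset (Fin n)) (τ : I → ℝ) (hτ : ∀ i, 0 < τ i) (y : I → ℝ)
    {V : Matrix (Fin n) (Fin n) ℝ} (hV : IsRChol (posteriorPrecision H (obsPrecision I τ) S) V) :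
    ∃ m, hvPosterior H μ S I τ y = volume.withDensity fun x =>
      ENNReal.ofReal (precisionDensity m V x) := by
  have hU := isRChol_hvFactor H hS
  set U := vecchiaFactor H.condSet S with hUdef
  obtain ⟨c, hc, z, hlik⟩ := likelihood_eq I τ hτ y
  have hAsymm : (U * Uᵀ)ᵀ = U * Uᵀ := by
    rw [Matrix.transpose_mul, Matrix.transpose_transpose]
  obtain ⟨m, k, hquad⟩ := quadratic_add_quadratic hAsymm
    (Matrix.diagonal_transpose (obsPrecision I τ))
    (isUnit_iff_ne_zero.2 hV.posDef.det_pos.ne') μ z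
  have hUdet := hU.upper.det_pos hU.diag_pos
  have hVdet := hV.upper.det_pos hV.diag_pos
  obtain ⟨K, hK, hprod⟩ : ∃ K : ℝ, K ≠ 0 ∧
      ∀ x, hvDensity H μ S x * likelihood I τ y x = K * precisionDensity m V x := by
    refine ⟨U.det * c * Real.exp (-(1 / 2) * k) / V.det, by positivity, fun x => ?_⟩
    have hexp : Real.exp (-(1 / 2) * ((x - μ) ⬝ᵥ ((U * Uᵀ) *ᵥ (x - μ)))) *
        Real.exp (-(1 / 2) * ((x - z) ⬝ᵥ (diagonal (obsPrecision I τ) *ᵥ (x - z)))) =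
        Real.exp (-(1 / 2) * ((x - m) ⬝ᵥ (posteriorPrecision H (obsPrecision I τ) S *ᵥ (x - m)))) *
          Real.exp (-(1 / 2) * k) := by
      rw [← Real.exp_add, ← Real.exp_add, ← mul_add, ← mul_add, hquad x]
      rfl
    rw [hvDensity_eq H μ hS, ← hUdef, hlik, precisionDensity_eq μ hU, precisionDensity_eq m hV]
    rw [div_mul_eq_mul_div, eq_div_iff hVdet.ne']
    linear_combination U.det * c * (√(2 * Real.pi))⁻¹ ^ n * V.det * hexp
  refine ⟨m, ?_⟩
  rw [hvPosterior]
  congr 1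
  funext x
  rw [posteriorDensity, integral_congr_ae (Filter.Eventually.of_forall hprod),
    integral_const_mul, integral_precisionDensity m hV, hprod, mul_one, mul_div_cancel_left₀ _ hK]

section

variable (H : Hierarchy n) {d : Fin n → ℝ} {S : Matrix (Fin n) (Fin n) ℝ}

theorem supportedOn_vecchiaFactor : SupportedOn H.Precedes (vecchiaFactor H.condSet S) :=
  fun _ _ => vecchiaFactor_support

/-- Off the diagonal the posterior precision equals `U Uᵀ`, so its nonzero entries are at comparable
positions. -/
theorem supportedOn_posterior {V : Matrix (Fin n) (Fin n) ℝ}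
    (hV : IsRChol (posteriorPrecision H d S) V) : SupportedOn H.Precedes V := by
  have hchain : ∀ i j k, H.Precedes i k → H.Precedes j k → H.Precedes i j ∨ H.Precedes j i :=
    fun i j k => Hierarchy.Precedes.comparable
  refine hV.supportedOn Hierarchy.isCompatibleOrder_precedes hchain fun i j hij => ?_
  by_cases h : i = j
  · exact Or.inl (Or.inl h)
  · rw [posteriorPrecision, Matrix.add_apply, Matrix.diagonal_apply_ne _ h, add_zero] at hij
    exact (supportedOn_vecchiaFactor H).mul_transpose hchain i j hij

end

/-- The Cholesky factors of a normal distribution, given the reverse Cholesky factor of the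
precision matrix. -/
theorem covMatrix_factors (m : Fin n → ℝ) {A U : Matrix (Fin n) (Fin n) ℝ} (h : IsRChol A U)
    {P : Measure (Fin n → ℝ)}
    (hP : P = volume.withDensity fun x => ENNReal.ofReal (precisionDensity m U x)) :
    rchol (covMatrix P)⁻¹ = U ∧ chol (covMatrix P) = (U⁻¹)ᵀ := by
  rw [hP, covMatrix_precisionDensity m h,
    Matrix.nonsing_inv_nonsing_inv _ (isUnit_iff_ne_zero.2 h.posDef.det_pos.ne')]
  exact ⟨h.rchol_eq, h.chol_inv_eq⟩

theorem Hierarchy.nonzeros_subset_upperPattern {H : Hierarchy n} {U : Matrix (Fin n) (Fin n) ℝ}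
    (hU : SupportedOn H.Precedes U) : nonzeros U ⊆ H.upperPattern :=
  fun p hp => hU p.1 p.2 hp

theorem Hierarchy.nonzeros_transpose_subset_lowerPattern {H : Hierarchy n}
    {U : Matrix (Fin n) (Fin n) ℝ} (hU : SupportedOn H.Precedes U) :
    nonzeros Uᵀ ⊆ H.lowerPattern :=
  fun p hp => hU p.2 p.1 hp

theorem Hierarchy.nonzeros_eq_upperPattern {H : Hierarchy n} {U : Matrix (Fin n) (Fin n) ℝ}
    (hU : SupportedOn H.Precedes U) (hne : ∀ j i, H.Precedes j i → U j i ≠ 0) :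
    nonzeros U = H.upperPattern :=
  (nonzeros_subset_upperPattern hU).antisymm fun p hp => hne p.1 p.2 hp

theorem Hierarchy.nonzeros_transpose_eq_lowerPattern {H : Hierarchy n}
    {U : Matrix (Fin n) (Fin n) ℝ} (hU : SupportedOn H.Precedes U)
    (hne : ∀ j i, H.Precedes j i → U j i ≠ 0) : nonzeros Uᵀ = H.lowerPattern :=
  (nonzeros_transpose_subset_lowerPattern hU).antisymm fun p hp => hne p.2 p.1 hp

/-! ### Analytic dependence on the covariance matrix -/

section

variable {E : Type*} [NormedAddCommGroup E] [NormedSpace ℝ E] {x : E}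

theorem analyticAt_det {ι : Type*} [Fintype ι] [DecidableEq ι] {M : E → Matrix ι ι ℝ}
    (hM : ∀ i j, AnalyticAt ℝ (fun y => M y i j) x) : AnalyticAt ℝ (fun y => (M y).det) x := by
  simp only [Matrix.det_apply']
  exact Finset.analyticAt_fun_sum _ fun σ _ =>
    analyticAt_const.mul (Finset.analyticAt_fun_prod _ fun i _ => hM _ _)

theorem analyticAt_inv {ι : Type*} [Fintype ι] [DecidableEq ι] {M : E → Matrix ι ι ℝ}
    (hM : ∀ i j, AnalyticAt ℝ (fun y => M y i j) x) (hx : (M x).det ≠ 0) (i j : ι) :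
    AnalyticAt ℝ (fun y => (M y)⁻¹ i j) x := by
  simp only [Matrix.inv_def, Ring.inverse_eq_inv', Matrix.smul_apply, smul_eq_mul,
    Matrix.adjugate_apply]
  refine ((analyticAt_det hM).inv hx).mul (analyticAt_det fun k l => ?_)
  by_cases hk : k = j
  · subst hk
    simpa using analyticAt_const
  · simpa [Matrix.updateRow_ne hk] using hM k l

theorem analyticAt_mul {M N : E → Matrix (Fin n) (Fin n) ℝ}
    (hM : ∀ i j, AnalyticAt ℝ (fun y => M y i j) x)
    (hN : ∀ i j, AnalyticAt ℝ (fun y => N y i j) x) (i j : Fin n) :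
    AnalyticAt ℝ (fun y => (M y * N y) i j) x := by
  simp only [Matrix.mul_apply]
  exact Finset.analyticAt_fun_sum _ fun k _ => (hM i k).mul (hN k j)

theorem analyticAt_mulVec {M : E → Matrix (Fin n) (Fin n) ℝ} {v : E → Fin n → ℝ}
    (hM : ∀ i j, AnalyticAt ℝ (fun y => M y i j) x)
    (hv : ∀ j, AnalyticAt ℝ (fun y => v y j) x) (i : Fin n) :
    AnalyticAt ℝ (fun y => (M y *ᵥ v y) i) x := by
  simp only [Matrix.mulVec, dotProduct]
  exact Finset.analyticAt_fun_sum _ fun k _ => (hM i k).mul (hv k)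

variable {S : E → Matrix (Fin n) (Fin n) ℝ} (hS : ∀ i j, AnalyticAt ℝ (fun y => S y i j) x)
  (hx : (S x).PosDef)
include hS hx

theorem analyticAt_residual (C : Finset (Fin n)) (i j : Fin n) :
    AnalyticAt ℝ (fun y => residual (S y) C i j) x := by
  have hG : ∀ k l, AnalyticAt ℝ (fun y => marginalPrecision (S y) C k l) x := by
    intro k l
    by_cases h : k ∈ C ∧ l ∈ C
    · simp only [marginalPrecision, Matrix.of_apply, dif_pos h]
      exact analyticAt_inv (fun _ _ => hS _ _) (hx.sub C).det_pos.ne' _ _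
    · simp only [marginalPrecision, Matrix.of_apply, dif_neg h]
      exact analyticAt_const
  exact analyticAt_const.sub (analyticAt_mulVec hG (fun l => hS l i) j)

theorem analyticAt_condVar (C : Finset (Fin n)) (i : Fin n) :
    AnalyticAt ℝ (fun y => condVar (S y) C i) x :=
  analyticAt_mulVec hS (fun j => analyticAt_residual hS hx C i j) i

variable {C : Fin n → Finset (Fin n)} (hC : ∀ i, ∀ k ∈ C i, k < i)
include hC

theorem analyticAt_vecchiaFactor (j i : Fin n) :
    AnalyticAt ℝ (fun y => vecchiaFactor C (S y) j i) x := by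
  have hσ := condVar_vecchia_pos hC hx i
  refine (analyticAt_residual hS hx _ _ _).div ?_ (Real.sqrt_pos.2 hσ).ne'
  exact ContDiffAt.analyticAt ((analyticAt_condVar hS hx _ _).contDiffAt.sqrt hσ.ne')

/-- Near `x` the matrix `S y` may fail to be symmetric, but positivity of the conditional variances
is an open condition. -/
theorem eventually_isRChol_vecchiaFactor : ∀ᶠ y in 𝓝 x,
    IsRChol (vecchiaFactor C (S y) * (vecchiaFactor C (S y))ᵀ) (vecchiaFactor C (S y)) := by
  have h : ∀ᶠ y in 𝓝 x, ∀ i, 0 < condVar (S y) (C i) i :=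
    Filter.eventually_all.2 fun i =>
      (analyticAt_condVar hS hx (C i) i).continuousAt.eventually_const_lt
        (condVar_vecchia_pos hC hx i)
  exact h.mono fun y hy => isRChol_vecchiaFactor_of_pos hC hy

end

/-- The reverse Cholesky factor of the posterior precision matrix. -/
noncomputable def posteriorFactor (H : Hierarchy n) (d : Fin n → ℝ)
    (S : Matrix (Fin n) (Fin n) ℝ) : Matrix (Fin n) (Fin n) ℝ :=
  rchol (posteriorPrecision H d S)

variable {H : Hierarchy n} {d : Fin n → ℝ}

theorem IsRChol.isRChol_add_diagonal {A U : Matrix (Fin n) (Fin n) ℝ} (h : IsRChol A U)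
    (hd : ∀ i, 0 ≤ d i) : IsRChol (A + diagonal d) (rchol (A + diagonal d)) := by
  obtain ⟨V, hV⟩ := (h.posDef_add_diagonal hd).exists_isRChol
  rwa [hV.rchol_eq]

theorem isRChol_posteriorFactor (hd : ∀ i, 0 ≤ d i) {S : Matrix (Fin n) (Fin n) ℝ}
    (hS : S.PosDef) : IsRChol (posteriorPrecision H d S) (posteriorFactor H d S) :=
  (isRChol_hvFactor H hS).isRChol_add_diagonal hd

section

variable {E : Type*} [NormedAddCommGroup E] [NormedSpace ℝ E] {x : E}
  {S : E → Matrix (Fin n) (Fin n) ℝ} (hS : ∀ i j, AnalyticAt ℝ (fun y => S y i j) x)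
  (hx : (S x).PosDef) (hd : ∀ i, 0 ≤ d i)
include hS hx hd

theorem analyticAt_posteriorFactor (j i : Fin n) :
    AnalyticAt ℝ (fun y => posteriorFactor H d (S y) j i) x := by
  have hC : ∀ i, ∀ k ∈ H.condSet i, k < i := fun i k hk => Hierarchy.lt_of_mem_condSet hk
  have hU := analyticAt_vecchiaFactor hS hx hC
  have hA : ∀ j i, AnalyticAt ℝ (fun y => posteriorPrecision H d (S y) j i) x := fun j i =>
    (analyticAt_mul hU (fun k l => hU l k) j i).add analyticAt_const
  have hev := (eventually_isRChol_vecchiaFactor hS hx hC).mono fun y hy =>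
    (hy.isRChol_add_diagonal hd).isChol_reverse
  have := IsChol.analyticAt hev (fun k l => hA k.rev l.rev) j.rev i.rev
  simpa only [reverse, posteriorFactor, posteriorPrecision, rchol, Matrix.submatrix_apply, Fin.rev_rev] using this

theorem analyticAt_posteriorFactor_inv (j i : Fin n) :
    AnalyticAt ℝ (fun y => (posteriorFactor H d (S y))⁻¹ j i) x :=
  analyticAt_inv (analyticAt_posteriorFactor hS hx hd)
    (isRChol_posteriorFactor hd hx).isUnit_det.ne_zero j i

end

/-! ### Generic covariance matrices -/

theorem posDef_segment {S T : Matrix (Fin n) (Fin n) ℝ} (hS : S.PosDef) (hT : T.PosDef) {t : ℝ}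
    (ht : t ∈ Set.Icc (0 : ℝ) 1) : (S + t • (T - S)).PosDef := by
  have h : S + t • (T - S) = (1 - t) • S + t • T := by
    rw [smul_sub, sub_smul, one_smul]
    abel
  rw [h]
  rcases eq_or_lt_of_le ht.1 with rfl | h0
  · simpa using hS
  · exact Matrix.PosDef.posSemidef_add (hS.posSemidef.smul (sub_nonneg.2 ht.2)) (hT.smul h0)

/-- An analytic function on positive definite matrices which is not identically zero is
generically nonzero. -/
theorem isOpen_dense_ne_zero {f : (Fin n → Fin n → ℝ) → ℝ}
    (hf : ∀ x, (Matrix.of x).PosDef → AnalyticAt ℝ f x)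
    {T : Matrix (Fin n) (Fin n) ℝ} (hT : T.PosDef) (hfT : f (Matrix.of.symm T) ≠ 0) :
    IsOpen {S : {S : Matrix (Fin n) (Fin n) ℝ // S.PosDef} | f (Matrix.of.symm S.1) ≠ 0} ∧
      Dense {S : {S : Matrix (Fin n) (Fin n) ℝ // S.PosDef} | f (Matrix.of.symm S.1) ≠ 0} := by
  constructor
  · have hcont : Continuous fun S : {S : Matrix (Fin n) (Fin n) ℝ // S.PosDef} =>
        f (Matrix.of.symm S.1) := by
      refine continuous_iff_continuousAt.2 fun S => ?_
      have hval : Continuous fun S : {S : Matrix (Fin n) (Fin n) ℝ // S.PosDef} =>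
        Matrix.of.symm S.1 := continuous_subtype_val
      exact (hf (Matrix.of.symm S.1) S.2).continuousAt.tendsto.comp hval.continuousAt
    exact isOpen_ne_fun hcont continuous_const
  · rw [dense_iff_inter_open]
    rintro O hO ⟨S, hSO⟩
    by_contra hempty
    have hzero : ∀ R ∈ O, f (Matrix.of.symm R.1) = 0 := fun R hR => by
      by_contra hne
      exact hempty ⟨R, hR, hne⟩
    obtain ⟨W, hW, rfl⟩ := isOpen_induced_iff.1 hO
    -- If `f` vanished near `S`, its restriction to the segment from `S` to `T` would vanish for
    -- small `t > 0`, hence up to `t = 1` by the identity theorem.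
    let γ : ℝ → Fin n → Fin n → ℝ := fun t => S.1 + t • (T - S.1)
    have hγ : ∀ t ∈ Set.Icc (0 : ℝ) 1, (Matrix.of (γ t)).PosDef := fun t ht =>
      posDef_segment S.2 hT ht
    have hγa : ∀ t, AnalyticAt ℝ γ t := fun t =>
      analyticAt_const.add (analyticAt_id.smul analyticAt_const)
    have hfγ : AnalyticOnNhd ℝ (f ∘ γ) (Set.Icc 0 1) := fun t ht =>
      (hf (γ t) (hγ t ht)).comp (hγa t)
    have hfreq : ∃ᶠ t in 𝓝[≠] (0 : ℝ), (f ∘ γ) t = 0 := by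
      have hle : 𝓝[>] (0 : ℝ) ≤ 𝓝[≠] 0 := nhdsWithin_mono _ fun t ht => ne_of_gt ht
      refine Filter.Frequently.filter_mono (Filter.Eventually.frequently ?_) hle
      have h0 : γ 0 = S.1 := by
        change S.1 + (0 : ℝ) • (T - S.1) = S.1
        rw [zero_smul, add_zero]
      have h1 : ∀ᶠ t in 𝓝 (0 : ℝ), γ t ∈ W :=
        (hγa 0).continuousAt.eventually_mem (hW.mem_nhds (by rw [h0]; exact hSO))
      filter_upwards [nhdsWithin_le_nhds h1, Ioo_mem_nhdsGT (zero_lt_one' ℝ)] with t ht ht'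
      exact hzero ⟨γ t, hγ t ⟨ht'.1.le, ht'.2.le⟩⟩ ht
    have h1 := hfγ.eqOn_zero_of_preconnected_of_frequently_eq_zero
      (convex_Icc 0 1).isPreconnected (Set.left_mem_Icc.2 zero_le_one) hfreq
      (Set.right_mem_Icc.2 zero_le_one)
    apply hfT
    have h2 : γ 1 = Matrix.of.symm T := by
      change S.1 + (1 : ℝ) • (T - S.1) = T
      rw [one_smul, add_sub_cancel]
    rw [← h2]
    exact h1

/-- Apart from the positions `(j, i)` and `(i, j)` the product is diagonal. Adding a diagonal matrix
can thus be absorbed into new values of `r` and `a`, which makes a posterior factor explicit. -/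
theorem diagonal_add_single_mul_transpose (r : Fin n → ℝ) (a : ℝ) (j i : Fin n) :
    (diagonal r + single j i a) * (diagonal r + single j i a)ᵀ =
      diagonal (fun k => r k * r k) + single j i (a * r i) + single i j (r i * a) +
        single j j (a * a) := by
  rw [Matrix.transpose_add, Matrix.diagonal_transpose, Matrix.transpose_single, Matrix.add_mul,
    Matrix.mul_add, Matrix.mul_add, Matrix.diagonal_mul_diagonal, Matrix.single_mul_single_same]
  have h1 : diagonal r * single i j a = single i j (r i * a) := by
    ext k l
    rw [Matrix.diagonal_mul]
    by_cases hk : i = k <;> by_cases hl : j = l <;> simp [hk, hl]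
  have h2 : single j i a * diagonal r = single j i (a * r i) := by
    ext k l
    by_cases hk : j = k <;> by_cases hl : i = l <;> simp [hk, hl]
  rw [h1, h2]
  abel

theorem isRChol_diagonal_add_single {r : Fin n → ℝ} (hr : ∀ k, 0 < r k) (a : ℝ) {j i : Fin n}
    (hji : j < i) : IsRChol ((diagonal r + single j i a) * (diagonal r + single j i a)ᵀ)
      (diagonal r + single j i a) where
  upper k l h := by
    by_contra hlt
    have h1 : k ≠ l := fun h => hlt h.le
    have h2 : ¬(j = k ∧ i = l) := by
      rintro ⟨rfl, rfl⟩
      exact hlt hji.le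
    exact h (by simp [h1, h2])
  diag_pos k := by
    have h2 : ¬(j = k ∧ i = k) := by
      rintro ⟨rfl, h⟩
      exact hji.ne' h
    simpa [Matrix.single_apply, h2] using hr k
  mul_transpose := rfl

/-- The prior factor `1 + single j i 1` respects the pattern, so the Vecchia approximation of the
corresponding covariance matrix is exact. The posterior factor has the same shape. -/
theorem exists_posteriorFactor_ne_zero (hd : ∀ i, 0 ≤ d i) {j i : Fin n} (hji : j ∈ H.condSet i) :
    ∃ S : Matrix (Fin n) (Fin n) ℝ, S.PosDef ∧ posteriorFactor H d S j i ≠ 0 ∧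
      (posteriorFactor H d S)⁻¹ j i ≠ 0 := by
  have hlt := Hierarchy.lt_of_mem_condSet hji
  have hC : ∀ i, ∀ k ∈ H.condSet i, k < i := fun i k hk => Hierarchy.lt_of_mem_condSet hk
  have hU := isRChol_diagonal_add_single (r := fun _ => (1 : ℝ)) (fun _ => one_pos) 1 hlt
  set U : Matrix (Fin n) (Fin n) ℝ := diagonal (fun _ => (1 : ℝ)) + single j i 1 with hUdef
  have hUC : ∀ k l, U k l ≠ 0 → k = l ∨ k ∈ H.condSet l := by
    intro k l h
    by_contra hn
    rw [not_or] at hn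
    have h2 : ¬(j = k ∧ i = l) := by
      rintro ⟨rfl, rfl⟩
      exact hn.2 hji
    exact h (by simp [hUdef, hn.1, h2])
  have hfac := vecchiaFactor_eq hC hU hUC
  -- With `a = (r i)⁻¹`, these values solve `r i * a = 1`, `r j ^ 2 + a ^ 2 = 2 + d j` and `r k ^ 2
  -- = 1 + d k` for `k ≠ j`.
  let r : Fin n → ℝ := fun k => if k = j then √(2 + d j - (1 + d i)⁻¹) else √(1 + d k)
  have hdi : 0 < 1 + d i := add_pos_of_pos_of_nonneg one_pos (hd i)
  have hpos : 0 < 2 + d j - (1 + d i)⁻¹ := by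
    have h1 : (1 + d i)⁻¹ ≤ 1 := inv_le_one_of_one_le₀ (le_add_of_nonneg_right (hd i))
    have h2 := hd j
    linarith
  have hr : ∀ k, 0 < r k := fun k => by
    by_cases hk : k = j
    · simpa [r, hk] using hpos
    · simpa [r, hk] using add_pos_of_pos_of_nonneg one_pos (hd k)
  have hri : r i * r i = 1 + d i := by
    simp only [r, if_neg hlt.ne']
    exact Real.mul_self_sqrt hdi.le
  have hV := isRChol_diagonal_add_single hr (r i)⁻¹ hlt
  have hprod : (diagonal r + single j i (r i)⁻¹) * (diagonal r + single j i (r i)⁻¹)ᵀ =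
      posteriorPrecision H d (U * Uᵀ)⁻¹ := by
    rw [posteriorPrecision, hfac, hUdef, diagonal_add_single_mul_transpose,
      diagonal_add_single_mul_transpose, inv_mul_cancel₀ (hr i).ne', mul_inv_cancel₀ (hr i).ne',
      ← mul_inv, hri, mul_one]
    have hdiag : diagonal (fun k => r k * r k) + single j j (1 + d i)⁻¹ =
        diagonal (fun _ => (1 : ℝ)) + single j j 1 + diagonal d := by
      ext k l
      by_cases hkl : k = l
      · subst hkl
        by_cases hk : k = j
        · subst hk
          simp only [Matrix.add_apply, Matrix.diagonal_apply_eq, Matrix.single_apply_same, r,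
            if_true, Real.mul_self_sqrt hpos.le]
          ring
        · have : r k * r k = 1 + d k := by
            simp only [r, if_neg hk]
            exact Real.mul_self_sqrt (add_nonneg zero_le_one (hd k))
          simp [Ne.symm hk, this]
      · have : ¬(j = k ∧ j = l) := fun h => hkl (h.1.symm.trans h.2)
        simp [hkl, this]
    rw [add_right_comm, add_right_comm (diagonal fun k => r k * r k), hdiag]
    abel
  rw [hprod] at hV
  refine ⟨(U * Uᵀ)⁻¹, hU.posDef.inv, ?_⟩
  rw [posteriorFactor, hV.rchol_eq]
  have ha : (r i)⁻¹ ≠ 0 := inv_ne_zero (hr i).ne'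
  refine ⟨by simpa [hlt.ne] using (hr i).ne', fun h0 => ?_⟩
  -- If the entry `(j, i)` of the inverse were zero, the entry `(j, i)` of the identity would be `(r
  -- i)⁻¹` times a diagonal entry of the inverse, which is nonzero.
  have h1 := congrFun (congrFun (Matrix.mul_nonsing_inv _ hV.isUnit_det) j) i
  rw [Matrix.add_mul, Matrix.add_apply, Matrix.diagonal_mul, h0, mul_zero, zero_add,
    Matrix.single_mul_apply_same, Matrix.one_apply_ne hlt.ne,
    hV.upper.inv_diag hV.diag_pos] at h1
  exact mul_ne_zero ha (inv_ne_zero (hV.diag_pos i).ne') h1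

/-- For generic covariance matrices, the factor of the precision matrix and its inverse have the
sparsity pattern given by the hierarchy. -/
theorem exists_isOpen_dense_posteriorFactor (H : Hierarchy n) (hd : ∀ i, 0 ≤ d i) :
    ∃ G : Set {S : Matrix (Fin n) (Fin n) ℝ // S.PosDef}, IsOpen G ∧ Dense G ∧ ∀ S ∈ G,
      ∀ j i, H.Precedes j i →
        posteriorFactor H d S.1 j i ≠ 0 ∧ (posteriorFactor H d S.1)⁻¹ j i ≠ 0 := by
  have key : ∀ p : Fin n × Fin n, ∃ G : Set {S : Matrix (Fin n) (Fin n) ℝ // S.PosDef},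
      IsOpen G ∧ Dense G ∧ ∀ S ∈ G, H.Precedes p.1 p.2 →
        posteriorFactor H d S.1 p.1 p.2 ≠ 0 ∧ (posteriorFactor H d S.1)⁻¹ p.1 p.2 ≠ 0 := by
    rintro ⟨j, i⟩
    by_cases hji : j ∈ H.condSet i
    · obtain ⟨T, hT, h1, h2⟩ := exists_posteriorFactor_ne_zero hd hji
      have hof : ∀ (x : Fin n → Fin n → ℝ) (k l : Fin n),
          AnalyticAt ℝ (fun y : Fin n → Fin n → ℝ => Matrix.of y k l) x := fun x k l =>
        ((ContinuousLinearMap.proj (R := ℝ) l).comp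
          (ContinuousLinearMap.proj (R := ℝ) (φ := fun _ : Fin n => Fin n → ℝ) k)).analyticAt x
      have hG1 := isOpen_dense_ne_zero (f := fun x => posteriorFactor H d (Matrix.of x) j i)
        (fun x hx => analyticAt_posteriorFactor (hof x) hx hd j i) hT h1
      have hG2 := isOpen_dense_ne_zero (f := fun x => (posteriorFactor H d (Matrix.of x))⁻¹ j i)
        (fun x hx => analyticAt_posteriorFactor_inv (hof x) hx hd j i) hT h2
      exact ⟨_, hG1.1.inter hG2.1, hG1.2.inter_of_isOpen_left hG2.2 hG1.1, fun S hS _ => hS⟩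
    · refine ⟨Set.univ, isOpen_univ, dense_univ, fun S _ h => ?_⟩
      obtain rfl : j = i := h.resolve_right hji
      have hV := isRChol_posteriorFactor (H := H) hd S.2
      refine ⟨(hV.diag_pos j).ne', ?_⟩
      rw [hV.upper.inv_diag hV.diag_pos]
      exact inv_ne_zero (hV.diag_pos j).ne'
  choose G hGo hGd hG using key
  have hfin : ∀ s : Finset (Fin n × Fin n), IsOpen (⋂ p ∈ s, G p) ∧ Dense (⋂ p ∈ s, G p) := by
    intro s
    induction s using Finset.induction_on with
    | empty => simp
    | insert p s _ ih =>
      rw [Finset.set_biInter_insert]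
      exact ⟨(hGo p).inter ih.1, (hGd p).inter_of_isOpen_left ih.2 (hGo p)⟩
  exact ⟨_, (hfin univ).1, (hfin univ).2, fun S hS j i =>
    hG (j, i) S (Set.mem_iInter₂.1 hS _ (mem_univ _))⟩

end HV

theorem proposition2 {n : ℕ} (H : HV.Hierarchy n) (μ : Fin n → ℝ)
    (I : Finset (Fin n)) (τ : I → ℝ) (hτ : ∀ i, 0 < τ i) :
    -- for every covariance matrix `S`: prior and posterior factors vanish off the pattern
    (∀ S : Matrix (Fin n) (Fin n) ℝ, S.PosDef → ∀ y : I → ℝ,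
      HV.WellDefined (HV.hvPrior H μ S) ∧ HV.WellDefined (HV.hvPosterior H μ S I τ y) ∧
      HV.nonzeros (HV.rchol (HV.covMatrix (HV.hvPrior H μ S))⁻¹) ⊆ H.upperPattern ∧
      HV.nonzeros (HV.rchol (HV.covMatrix (HV.hvPosterior H μ S I τ y))⁻¹) ⊆ H.upperPattern ∧
      HV.nonzeros (HV.chol (HV.covMatrix (HV.hvPrior H μ S))) ⊆ H.lowerPattern ∧
      HV.nonzeros (HV.chol (HV.covMatrix (HV.hvPosterior H μ S I τ y))) ⊆ H.lowerPattern) ∧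
    -- for generic `S`, the positions of the nonzero entries are exactly the pattern
    (∃ G : Set {S : Matrix (Fin n) (Fin n) ℝ // S.PosDef}, IsOpen G ∧ Dense G ∧
      ∀ S ∈ G, ∀ y : I → ℝ,
        HV.nonzeros (HV.rchol (HV.covMatrix (HV.hvPosterior H μ S.1 I τ y))⁻¹) =
          HV.nonzeros (HV.rchol (HV.covMatrix (HV.hvPrior H μ S.1))⁻¹) ∧
        HV.nonzeros (HV.rchol (HV.covMatrix (HV.hvPrior H μ S.1))⁻¹) = H.upperPattern ∧
        HV.nonzeros (HV.chol (HV.covMatrix (HV.hvPosterior H μ S.1 I τ y))) =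
          HV.nonzeros (HV.chol (HV.covMatrix (HV.hvPrior H μ S.1))) ∧
        HV.nonzeros (HV.chol (HV.covMatrix (HV.hvPrior H μ S.1))) = H.lowerPattern) := by
  have hd := HV.obsPrecision_nonneg I τ
  have hr := HV.Hierarchy.isCompatibleOrder_precedes (H := H)
  have hpost := fun {S : Matrix (Fin n) (Fin n) ℝ} (hS : S.PosDef) (y : I → ℝ) =>
    HV.hvPosterior_eq H μ hS I τ hτ y (HV.isRChol_posteriorFactor hd hS)
  constructor
  · intro S hS y
    obtain ⟨m, hm⟩ := hpost hS y
    have hU := HV.isRChol_hvFactor H hS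
    have hV := HV.isRChol_posteriorFactor (H := H) hd hS
    have hUs := HV.supportedOn_vecchiaFactor H (S := S)
    have hVs := HV.supportedOn_posterior H hV
    obtain ⟨h1, h2⟩ := HV.covMatrix_factors μ hU (HV.hvPrior_eq H μ hS)
    obtain ⟨h3, h4⟩ := HV.covMatrix_factors m hV hm
    rw [h1, h2, h3, h4]
    refine ⟨?_, ?_, HV.Hierarchy.nonzeros_subset_upperPattern hUs,
      HV.Hierarchy.nonzeros_subset_upperPattern hVs,
      HV.Hierarchy.nonzeros_transpose_subset_lowerPattern (hUs.inv hr hU.diag_pos),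
      HV.Hierarchy.nonzeros_transpose_subset_lowerPattern (hVs.inv hr hV.diag_pos)⟩
    · rw [HV.hvPrior_eq H μ hS]
      exact HV.wellDefined_precisionDensity μ hU
    · rw [hm]
      exact HV.wellDefined_precisionDensity m hV
  · obtain ⟨G, hGo, hGd, hG⟩ := HV.exists_isOpen_dense_posteriorFactor H hd
    -- With `d = 0` the posterior factor is the prior factor.
    obtain ⟨G', hGo', hGd', hG'⟩ :=
      HV.exists_isOpen_dense_posteriorFactor H (d := 0) fun _ => le_rfl
    refine ⟨G ∩ G', hGo.inter hGo', hGd.inter_of_isOpen_left hGd' hGo, fun S hSG y => ?_⟩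
    obtain ⟨m, hm⟩ := hpost S.2 y
    have hU := HV.isRChol_hvFactor H S.2
    have hV := HV.isRChol_posteriorFactor (H := H) hd S.2
    have hUs := HV.supportedOn_vecchiaFactor H (S := S.1)
    have hVs := HV.supportedOn_posterior H hV
    have hUne := hG' S hSG.2
    rw [HV.posteriorFactor, HV.posteriorPrecision_zero, hU.rchol_eq] at hUne
    have hVne := hG S hSG.1
    obtain ⟨h1, h2⟩ := HV.covMatrix_factors μ hU (HV.hvPrior_eq H μ S.2)
    obtain ⟨h3, h4⟩ := HV.covMatrix_factors m hV hm
    rw [h1, h2, h3, h4,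
      HV.Hierarchy.nonzeros_eq_upperPattern hUs fun j i h => (hUne j i h).1,
      HV.Hierarchy.nonzeros_eq_upperPattern hVs fun j i h => (hVne j i h).1,
      HV.Hierarchy.nonzeros_transpose_eq_lowerPattern (hUs.inv hr hU.diag_pos)
        fun j i h => (hUne j i h).2,
      HV.Hierarchy.nonzeros_transpose_eq_lowerPattern (hVs.inv hr hV.diag_pos)
        fun j i h => (hVne j i h).2]
    exact ⟨rfl, rfl, rfl, rfl⟩
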